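/- Let $M$ be a connected smooth manifold (Hausdorff, second countable) of even dimension $n=p+q\ge 3$, and let $c$ be a conformal class of smooth semi-Riemannian metrics of signature $(p,q)$ on $M$ (that is, $c=\{e^{2\sigma}g : \sigma\in C^\infty(M)\}$). Let $(\mathcal T,h,\nabla^{nc})$ be the standard tractor bundle of $(M,c)$ with its tractor metric and normal conformal tractor connection. In the splitting $\mathcal T\cong\underline{\mathbb R}\oplus TM\oplus\underline{\mathbb R}$ given by any $g\in c$, with elements written $(\alpha,Y,\beta)=\alpha s_-+Y+\beta s_+$, these are $$h\big((\alpha_1,Y_1,\beta_1),(\alpha_2,Y_2,\beta_2)\big)=\alpha_1\beta_2+\alpha_2\beta_1+g(Y_1,Y_2),$$ $$\nabla^{nc}_X(\alpha,Y,\beta)=\big(X(\alpha)-\mathsf P(X,Y),\ \nabla^g_XY+\alpha X+\beta\,\mathsf P(X),\ X(\beta)-g(X,Y)\big),$$ where $\nabla^g$ is the Levi-Civita connection and $\mathsf P=\frac1{n-2}\big(\mathrm{Ric}^g-\frac{\mathrm{scal}^g}{2(n-1)}g\big)$ is the Schouten tensor of $g$, regarded also as an endomorphism of $TM$. Let $\mathcal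 I=\mathbb R s_-$ be the distinguished null line, with orthogonal complement $\mathcal I^\perp$ with respect to $h$. For $x\in M$ let $\mathrm{Hol}^0_x(M,c)$ be the restricted holonomy group (the identity component of the holonomy group) of $\nabla^{nc}$ at $x$, consisting of the parallel transports along null-homotopic piecewise smooth loops at $x$, and let $\mathfrak{hol}_x(M,c)\subset\mathfrak{so}(\mathcal T_x,h_x)$ be its Lie algebra. The conformal holonomy distribution is $$\mathcal E_x=\{\mathrm{pr}_{T_xM}(A\tau) : \tau\in\mathcal T_x,\ A\in\mathfrak{hol}_x(M,c),\ A\,\mathcal I=0,\ h(A\,\mathcal I^\perp,\mathcal I^\perp)=0\}\subset T_xM,$$ a linear subspace of $T_xM$ that does not depend on the choice of $g\in c$, and $r^{\mathcal E}(x)=\dim\mathcal E_x$. Let $\mathcal N\subset\mathbb R^{p+1,q+1}$ be the light cone of nonzero null vectors. A linear isometry $\mathbb R^{p+1,q+1}\to(\mathcal T_x,h_x)$ makes $\mathrm{Hol}^0_x(M,c)$ act on $\mathcal N$; since $M$ is connected, this action is independent of $x$ and of the isometry up to conjugation. Then at least one of the following holds: 1. there is an open dense subset of $M$ on which $r^{\mathcal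 E}\le 1$; or 2. $\mathrm{Hol}^0(M,c)$ acts on the light cone $\mathcal N\subset\mathbb R^{p+1,q+1}$ with an open orbit, i.e. for every $x\in M$ and every linear isometry $\mathbb R^{p+1,q+1}\to\mathcal T_x$ some orbit of $\mathrm{Hol}^0_x(M,c)$ in $\mathcal N$ is open in $\mathcal N$. -/

import Mathlib

open Set Topology Manifold ContDiff

noncomputable section

namespace ConfHol

/-! ### Semi-Riemannian geometry in coordinates

`G` is a field of symmetric nondegenerate bilinear forms on (an open subset of) `ℝⁿ`. -/

/-- Coordinate space `ℝⁿ`. -/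
abbrev E (n : ℕ) : Type := EuclideanSpace ℝ (Fin n)

/-- Bilinear forms on `ℝⁿ`. -/
abbrev Bil (n : ℕ) : Type := E n →L[ℝ] E n →L[ℝ] ℝ

/-- The `i`-th coordinate vector `∂ᵢ`. -/
def ebasis {n : ℕ} (i : Fin n) : E n := EuclideanSpace.single i 1

/-- The vector `θ♯` with `G(θ♯, ·) = θ`. -/
def sharp {n : ℕ} (G : E n → Bil n) (y : E n) (θ : E n →L[ℝ] ℝ) : E n :=
  (G y).inverse θ

/-- The Levi-Civita Christoffel symbol `Γ(u, v)`, determined by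
`2 G(Γ(u, v), w) = (∂ᵤ G)(v, w) + (∂ᵥ G)(u, w) - (∂_w G)(u, v)`. -/
def christoffel {n : ℕ} (G : E n → Bil n) (y u v : E n) : E n :=
  sharp G y ((1 / 2 : ℝ) •
    (fderiv ℝ G y u v + fderiv ℝ G y v u - ((fderiv ℝ G y).flip u).flip v))

/-- The curvature `R(u, v) w = [∇ᵤ, ∇ᵥ] w` on coordinate vector fields. -/
def curvature {n : ℕ} (G : E n → Bil n) (y u v w : E n) : E n :=
  fderiv ℝ (fun z => christoffel G z v w) y u - fderiv ℝ (fun z => christoffel G z u w) y v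
    + christoffel G y u (christoffel G y v w) - christoffel G y v (christoffel G y u w)

/-- `Ric(v, w) = tr (u ↦ R(u, v) w)`. -/
def ricci {n : ℕ} (G : E n → Bil n) (y v w : E n) : ℝ :=
  ∑ i : Fin n, curvature G y (ebasis i) v w i

/-- The scalar curvature `tr_G Ric`. -/
def scalarCurv {n : ℕ} (G : E n → Bil n) (y : E n) : ℝ :=
  ∑ i : Fin n, ricci G y (sharp G y (EuclideanSpace.proj i)) (ebasis i)

/-- The Schouten tensor `P = (Ric - scal / (2 (n - 1)) G) / (n - 2)`. -/
def schouten {n : ℕ} (G : E n → Bil n) (y v w : E n) : ℝ :=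
  (1 / ((n : ℝ) - 2)) * (ricci G y v w - scalarCurv G y / (2 * ((n : ℝ) - 1)) * G y v w)

/-- The Schouten tensor as an endomorphism: `G(P(v), w) = P(v, w)`. -/
def schoutenEnd {n : ℕ} (G : E n → Bil n) (y v : E n) : E n :=
  ∑ i : Fin n, schouten G y v (ebasis i) • sharp G y (EuclideanSpace.proj i)

/-! ### Metrics and conformal structures on a manifold -/

/-- A smooth semi-Riemannian metric of signature `(p, q)` (`p` negative and `q` positive
directions, so that `p + q = n`) on an `n`-dimensional manifold. -/
structure Metric (n p q : ℕ) (M : Type*) [TopologicalSpace M] [ChartedSpace (E n) M]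
    [IsManifold (𝓡 n) ∞ M] where
  val : ∀ x : M, TangentSpace (𝓡 n) x →L[ℝ] TangentSpace (𝓡 n) x →L[ℝ] ℝ
  smooth : ContMDiff (𝓡 n) ((𝓡 n).prod 𝓘(ℝ, Bil n)) ∞
    (fun x => Bundle.TotalSpace.mk' (Bil n)
      (E := fun x : M => TangentSpace (𝓡 n) x →L[ℝ] TangentSpace (𝓡 n) x →L[ℝ] ℝ) x (val x))
  symm : ∀ (x : M) (v w : TangentSpace (𝓡 n) x), val x v w = val x w v
  signature : ∀ x : M, ∃ b : Module.Basis (Fin p ⊕ Fin q) ℝ (TangentSpace (𝓡 n) x),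
    ∀ i j, val x (b i) (b j) =
      if i = j then Sum.elim (fun _ => (-1 : ℝ)) (fun _ => 1) i else 0

/-- Conformal equivalence `g' = e^{2σ} g` with `σ` smooth. -/
def ConformallyEquivalent {n p q : ℕ} {M : Type*} [TopologicalSpace M] [ChartedSpace (E n) M]
    [IsManifold (𝓡 n) ∞ M] (g g' : Metric n p q M) : Prop :=
  ∃ σ : M → ℝ, ContMDiff (𝓡 n) 𝓘(ℝ, ℝ) ∞ σ ∧
    ∀ (x : M) (v w : TangentSpace (𝓡 n) x), g'.val x v w = Real.exp (2 * σ x) * g.val x v w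

/-- Conformal equivalence is an equivalence relation. -/
def conformalSetoid (n p q : ℕ) (M : Type*) [TopologicalSpace M] [ChartedSpace (E n) M]
    [IsManifold (𝓡 n) ∞ M] : Setoid (Metric n p q M) where
  r := ConformallyEquivalent
  iseqv :=
    { refl := fun g => ⟨fun _ => 0, contMDiff_const, by simp⟩
      symm := by
        rintro g g' ⟨σ, hσ, h⟩
        refine ⟨fun x => -σ x, hσ.neg, fun x v w => ?_⟩
        rw [h, ← mul_assoc, ← Real.exp_add]
        simp
      trans := by
        rintro g g' g'' ⟨σ, hσ, h⟩ ⟨σ', hσ', h'⟩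
        refine ⟨fun x => σ' x + σ x, hσ'.add hσ, fun x v w => ?_⟩
        rw [h', h, ← mul_assoc, ← Real.exp_add, mul_add] }

/-- A conformal structure of signature `(p, q)`: a conformal class `c = [g]` of metrics. -/
def ConformalStructure (n p q : ℕ) (M : Type*) [TopologicalSpace M] [ChartedSpace (E n) M]
    [IsManifold (𝓡 n) ∞ M] : Type _ :=
  Quotient (conformalSetoid n p q M)

/-- `g ∈ c`. -/
instance {n p q : ℕ} {M : Type*} [TopologicalSpace M] [ChartedSpace (E n) M]
    [IsManifold (𝓡 n) ∞ M] : Membership (Metric n p q M) (ConformalStructure n p q M) where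
  mem c g := Quotient.mk (conformalSetoid n p q M) g = c

section Manifold

variable {n p q : ℕ} {M : Type*} [TopologicalSpace M] [ChartedSpace (E n) M]
  [IsManifold (𝓡 n) ∞ M]

/-- The components of `g` in the chart of `M` centred at `x₀`. -/
def coordMetric (g : Metric n p q M) (x₀ : M) (y : E n) : Bil n :=
  let B : Bil n := g.val ((extChartAt (𝓡 n) x₀).symm y)
  let D : E n →L[ℝ] E n := mfderiv 𝓘(ℝ, E n) (𝓡 n) (extChartAt (𝓡 n) x₀).symm y
  B.bilinearComp D D

/-! ### The standard tractor bundle in the splitting given by `g ∈ c` -/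

/-- The fibre of the standard tractor bundle: under the splitting `𝒯 ≅ ℝ ⊕ TM ⊕ ℝ` given by
`g ∈ c`, a tractor at `x` is `α s₋ + Y + β s₊ = (α, Y, β)` with `Y ∈ T_x M`. (As a type,
`TangentSpace (𝓡 n) x` is `E n`, read in the chart centred at `x`.) -/
abbrev Tractor (n : ℕ) : Type := ℝ × E n × ℝ

/-- The tractor metric `h` at `x`. -/
def tractorMetric (g : Metric n p q M) (x : M) (τ τ' : Tractor n) : ℝ :=
  τ.1 * τ'.2.2 + τ'.1 * τ.2.2 + g.val x τ.2.1 τ'.2.1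

/-- The tractor `s₋`, which spans the distinguished null line `ℐ`. -/
def sMinus (n : ℕ) : Tractor n := (1, 0, 0)

/-- The tractor field `τ = (α, Y, β)` along the curve `γ` satisfies `∇^{nc}_{γ'} τ = 0` at time `t`,
where
`∇^{nc}_X (α, Y, β) = (X(α) - P(X, Y), ∇_X Y + α X + β P(X), X(β) - g(X, Y))`
is the normal conformal tractor connection in the splitting given by `g`.
Everything is computed in the chart centred at `γ t`, where `∇_{γ'} Y = Y' + Γ(γ', Y)`. -/
structure IsParallelAt (g : Metric n p q M) (γ : ℝ → M) (τ : ℝ → Tractor n) (t : ℝ) : Prop where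
  top : HasDerivAt (fun s => (τ s).1)
    (schouten (coordMetric g (γ t)) (extChartAt (𝓡 n) (γ t) (γ t))
      (deriv (fun s => extChartAt (𝓡 n) (γ t) (γ s)) t) (τ t).2.1) t
  mid : HasDerivAt (fun s => (mfderiv (𝓡 n) 𝓘(ℝ, E n) (extChartAt (𝓡 n) (γ t)) (γ s) (τ s).2.1 : E n))
    (-(christoffel (coordMetric g (γ t)) (extChartAt (𝓡 n) (γ t) (γ t))
        (deriv (fun s => extChartAt (𝓡 n) (γ t) (γ s)) t) (τ t).2.1)
      - (τ t).1 • deriv (fun s => extChartAt (𝓡 n) (γ t) (γ s)) t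
      - (τ t).2.2 • schoutenEnd (coordMetric g (γ t)) (extChartAt (𝓡 n) (γ t) (γ t))
        (deriv (fun s => extChartAt (𝓡 n) (γ t) (γ s)) t)) t
  bot : HasDerivAt (fun s => (τ s).2.2)
    (coordMetric g (γ t) (extChartAt (𝓡 n) (γ t) (γ t))
      (deriv (fun s => extChartAt (𝓡 n) (γ t) (γ s)) t) (τ t).2.1) t

/-- `γ : [0, 1] → M` is piecewise smooth: for some finite set `F` of times, `γ` is smooth (up to
the end points) on each closed interval without points of `F` in its interior. -/
def IsPiecewiseSmooth (γ : ℝ → M) : Prop :=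
  ∃ F : Finset ℝ, ∀ a b : ℝ, 0 ≤ a → a < b → b ≤ 1 → (∀ t ∈ F, t ∉ Ioo a b) →
    ContMDiffOn 𝓘(ℝ, ℝ) (𝓡 n) ∞ γ (Icc a b)

/-- `τ` is a parallel tractor field along the piecewise smooth curve `γ : [0, 1] → M`: it is
continuous, and `∇^{nc}_{γ'} τ = 0` except at finitely many times. -/
def IsParallelAlong (g : Metric n p q M) (γ : ℝ → M) (τ : ℝ → Tractor n) : Prop :=
  ContinuousOn (fun t => (τ t).1) (Icc 0 1) ∧
  ContinuousOn (fun t => (Bundle.TotalSpace.mk (γ t) (τ t).2.1 : TangentBundle (𝓡 n) M))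
    (Icc 0 1) ∧
  ContinuousOn (fun t => (τ t).2.2) (Icc 0 1) ∧
  ∃ F : Finset ℝ, ∀ t ∈ Ioo (0 : ℝ) 1, t ∉ F → IsParallelAt g γ τ t

/-- The restricted conformal holonomy group `Hol⁰_x(M, c)`, i.e. the identity component of the
holonomy group: the parallel transports of `∇^{nc}` along the null-homotopic piecewise smooth
loops at `x`. -/
def holonomy0 (g : Metric n p q M) (x : M) : Set (Tractor n →L[ℝ] Tractor n) :=
  {A | ∃ γ : Path x x, IsPiecewiseSmooth (n := n) γ.extend ∧ γ.Homotopic (Path.refl x) ∧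
    ∀ v : Tractor n, ∃ τ : ℝ → Tractor n,
      IsParallelAlong g γ.extend τ ∧ τ 0 = v ∧ τ 1 = A v}

/-- The conformal holonomy algebra `𝔥𝔬𝔩_x(M, c)`, the Lie algebra of the holonomy group: the
tangent vectors at the identity of the smooth curves in `Hol⁰_x(M, c)`. (They form a vector
space.) -/
def holAlg (g : Metric n p q M) (x : M) : Submodule ℝ (Tractor n →L[ℝ] Tractor n) :=
  Submodule.span ℝ {A | ∃ c : ℝ → (Tractor n →L[ℝ] Tractor n), ContDiff ℝ ∞ c ∧
    (∀ t, c t ∈ holonomy0 g x) ∧ c 0 = ContinuousLinearMap.id ℝ (Tractor n) ∧ HasDerivAt c A 0}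

/-- The conformal holonomy distribution at `x`: the subspace `ℰ_x` of the `pr_{TM} (A τ)`,
for tractors `τ` and those `A ∈ 𝔥𝔬𝔩_x(M, c)` with `A ℐ = 0` and `h(A ℐ^⊥, ℐ^⊥) = 0`. -/
def holDistribution (g : Metric n p q M) (x : M) : Submodule ℝ (TangentSpace (𝓡 n) x) :=
  Submodule.span ℝ {X | ∃ A ∈ holAlg g x, A (sMinus n) = 0 ∧
    (∀ τ τ' : Tractor n, tractorMetric g x (sMinus n) τ = 0 →
      tractorMetric g x (sMinus n) τ' = 0 → tractorMetric g x (A τ) τ' = 0) ∧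
    ∃ τ : Tractor n, X = (A τ).2.1}

/-- The function `r^ℰ(x) = dim ℰ_x`. -/
def rankE (g : Metric n p q M) (x : M) : ℕ := Module.finrank ℝ (holDistribution g x)

/-! ### The action on the null cone -/

/-- The vector space underlying `ℝ^{p+1,q+1}`. -/
abbrev PseudoSpace (p q : ℕ) : Type := Fin (p + 1) ⊕ Fin (q + 1) → ℝ

/-- The scalar product of `ℝ^{p+1,q+1}`. -/
def pseudoInner {p q : ℕ} (v w : PseudoSpace p q) : ℝ :=
  -(∑ i, v (Sum.inl i) * w (Sum.inl i)) + ∑ j, v (Sum.inr j) * w (Sum.inr j)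

/-- The light cone `𝒩 ⊂ ℝ^{p+1,q+1}` of nonzero null vectors. -/
def nullCone (p q : ℕ) : Set (PseudoSpace p q) := {v | v ≠ 0 ∧ pseudoInner v v = 0}

/-- Linear isometries `ℝ^{p+1,q+1} → (𝒯_x, h)`. -/
def IsTractorFrame (g : Metric n p q M) (x : M) (ψ : PseudoSpace p q ≃ₗ[ℝ] Tractor n) : Prop :=
  ∀ v w, tractorMetric g x (ψ v) (ψ w) = pseudoInner v w

/-- `Hol⁰(M, c)` acts on `𝒩 ⊂ ℝ^{p+1,q+1}` with an open orbit, where it acts on `ℝ^{p+1,q+1}`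
after the choice of a base point `x` and of a linear isometry `ℝ^{p+1,q+1} → 𝒯_x`; the assertion
is made for every choice (of which there is at least one at every `x`). -/
def HasOpenOrbit (g : Metric n p q M) : Prop :=
  ∀ x : M, (∃ ψ : PseudoSpace p q ≃ₗ[ℝ] Tractor n, IsTractorFrame g x ψ) ∧
    ∀ ψ : PseudoSpace p q ≃ₗ[ℝ] Tractor n, IsTractorFrame g x ψ →
      ∃ v ∈ nullCone p q,
        IsOpen {w : nullCone p q | ∃ A ∈ holonomy0 g x, ψ.symm (A (ψ v)) = (w : PseudoSpace p q)}

end Manifold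

end ConfHol

end

/-! Suppose that `r^ℰ` does not vanish on any open dense set. Then it is nonzero on a dense subset
of a neighbourhood of some `x₀`. Let `A ∈ hol_y` be as in the definition of `ℰ_y`, with a nonzero
contribution to `ℰ_y`. As `A` is skew and `A s₋ = 0`, `h(A s₋^⊥, s₋^⊥) = 0`, it is a wedge `s₋ ∧ k`
with `k ⊥ s₋` and `k ∉ ℝ s₋`: an infinitesimal null rotation at the null line `ℝ s₋`.

Let `P(ξ)` be the parallel transport from `x₀` along the segment `ξ` in a chart. Transporting `A`
back to `x₀` gives a wedge of `P(ξ)⁻¹ s₋` in `hol_{x₀}`. Up to scaling, `P(ξ)⁻¹ s₋` is the null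
vector `(1, z, *)` for a local coordinate `z = z(ξ)`, because `ξ ↦ P(ξ)⁻¹ s₋` has the invertible
derivative `ξ ↦ (0, ξ, 0)` at `0`. Hence `hol_{x₀}` contains wedges of `(1, z, *)` with nonzero
tangent vectors `w` of the cone for a dense set of `z` in an open set. Near a point where the space
of admissible `w` has minimal dimension, `w` can be chosen to depend continuously on `z`.

Now let the wedge at `y + tX` act on `(1, y, *)` and let `t → 0`: the limits, after division by a
power of `t`, show that the tangent space at `(1, y, *)` of its orbit contains `(1, y, *)` itself
and, for `n ≥ 3`, the whole tangent space of the cone. So this orbit is open at one point, and being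
homogeneous it is open. Finally, parallel transport conjugates holonomy groups, so that having an
open orbit is a locally constant property of the base point, and `M` is connected. -/

noncomputable section

namespace ConfHol

set_option maxSynthPendingDepth 3

section SomewhereDense

variable {X Y : Type*} [TopologicalSpace X] [TopologicalSpace Y]

theorem mem_interior_closure_iff_preimage (e : OpenPartialHomeomorph X Y) {x : X}
    (hx : x ∈ e.source) {S : Set Y} :
    e x ∈ interior (closure S) ↔ x ∈ interior (closure (e ⁻¹' S)) := by
  have hfreq : ∀ x' ∈ e.source, e x' ∈ closure S ↔ x' ∈ closure (e ⁻¹' S) := fun x' hx' => by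
    simp only [mem_closure_iff_frequently, ← e.map_nhds_eq hx', Filter.frequently_map,
      mem_preimage]
  simp only [mem_interior_iff_mem_nhds, ← e.map_nhds_eq hx, Filter.mem_map]
  refine Filter.eventually_congr ?_
  filter_upwards [e.open_source.mem_nhds hx] with x' hx' using hfreq x' hx'

theorem mem_interior_closure_of_eventually_imp {x : X} {S T : Set X}
    (hx : x ∈ interior (closure S)) (h : ∀ᶠ y in 𝓝 x, y ∈ S → y ∈ T) :
    x ∈ interior (closure T) := by
  rw [mem_interior_iff_mem_nhds] at hx ⊢
  filter_upwards [hx, h.eventually_nhds] with y hyS hy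
  exact mem_closure_iff_frequently.2 ((mem_closure_iff_frequently.1 hyS).mp hy)

end SomewhereDense

section KernelSections

theorem exists_map_sub_map_mem {K V W : Type*} [DivisionRing K] [AddCommGroup V] [Module K V]
    [AddCommGroup W] [Module K W] (T : V →ₗ[K] W) (h : Submodule K W) :
    ∃ P : W →ₗ[K] V, h ≤ LinearMap.ker P ∧ ∀ x, T x - T (P (T x)) ∈ h := by
  let T' : V →ₗ[K] W ⧸ h := h.mkQ ∘ₗ T
  obtain ⟨s, hs⟩ := T'.rangeRestrict.exists_rightInverse_of_surjective T'.range_rangeRestrict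
  obtain ⟨P, hP⟩ := s.exists_extend
  refine ⟨P ∘ₗ h.mkQ, fun x hx => by simp [(Submodule.Quotient.mk_eq_zero h).2 hx], fun x => ?_⟩
  have hPs : P (T' x) = s (T'.rangeRestrict x) := DFunLike.congr_fun hP (T'.rangeRestrict x)
  have hsT : T' (s (T'.rangeRestrict x)) = T' x :=
    congrArg Subtype.val (DFunLike.congr_fun hs (T'.rangeRestrict x))
  refine (Submodule.Quotient.eq h).1 ?_
  change T' x = T' (P (T' x))
  rw [hPs, hsT]

theorem eq_comap_of_finrank_le {K V : Type*} [DivisionRing K] [AddCommGroup V] [Module K V]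
    [FiniteDimensional K V] {S : V →ₗ[K] V} (hS : Function.Injective S) {N N' : Submodule K V}
    (hle : N ≤ N'.comap S) (hfin : Module.finrank K N' ≤ Module.finrank K N) : N = N'.comap S := by
  refine Submodule.eq_of_le_of_finrank_le hle (le_trans ?_ hfin)
  rw [(Submodule.equivMapOfInjective S hS (N'.comap S)).finrank_eq]
  exact Submodule.finrank_mono (Submodule.map_comap_le S N')

variable {𝕜 X V W : Type*} [NontriviallyNormedField 𝕜] [CompleteSpace 𝕜] [TopologicalSpace X]
  [NormedAddCommGroup V] [NormedSpace 𝕜 V]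
  [NormedAddCommGroup W] [NormedSpace 𝕜 W] [FiniteDimensional 𝕜 W]

theorem exists_continuous_comap_le_comap_comap {F : X → V →L[𝕜] W} (hF : Continuous F)
    (h : Submodule 𝕜 W) (y₁ : X) :
    ∃ S : X → V →L[𝕜] V, Continuous S ∧ S y₁ = 1 ∧
      ∀ y x, F y x ∈ h → F y₁ (S y x) ∈ h := by
  obtain ⟨P, hPh, hP⟩ := exists_map_sub_map_mem (F y₁ : V →ₗ[𝕜] W) h
  let P' : W →L[𝕜] V := P.toContinuousLinearMap
  refine ⟨fun y => 1 - P' ∘L F y₁ + P' ∘L F y, by fun_prop, by simp, fun y x hx => ?_⟩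
  have hPF : P' (F y x) = 0 := hPh hx
  have hP'F : F y₁ x - F y₁ (P' (F y₁ x)) ∈ h := hP x
  simpa [hPF] using hP'F

variable [FiniteDimensional 𝕜 V]

/-- The minimal kernel dimension is attained at some `y₁`, and near `y₁` the kernels are the
preimages of a fixed subspace under an invertible family equal to `1` at `y₁`. -/
theorem exists_continuousAt_section_mem {F : X → V →L[𝕜] W} (hF : Continuous F)
    (h : Submodule 𝕜 W) (hD : (interior (closure {y | ∃ w ≠ 0, F y w ∈ h})).Nonempty) :
    ∃ y₁, ∃ κ : X → V, ContinuousAt κ y₁ ∧ κ y₁ ≠ 0 ∧ ∀ᶠ y in 𝓝 y₁, F y (κ y) ∈ h := by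
  have : CompleteSpace V := FiniteDimensional.complete 𝕜 V
  let N : X → Submodule 𝕜 V := fun y => h.comap (F y : V →ₗ[𝕜] W)
  let O : Set X := interior (closure {y | ∃ w ≠ 0, F y w ∈ h})
  obtain ⟨y₁, hy₁, hmin⟩ : ∃ y₁ ∈ O, ∀ y ∈ O, Module.finrank 𝕜 (N y₁) ≤ Module.finrank 𝕜 (N y) :=
    ⟨_, Function.argminOn_mem _ O hD, fun y hy => Function.argminOn_le (fun y =>
      Module.finrank 𝕜 (N y)) O hy⟩
  obtain ⟨S, hS, hS1, hSN⟩ := exists_continuous_comap_le_comap_comap hF h y₁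
  have hunit : ∀ᶠ y in 𝓝 y₁, IsUnit (S y) :=
    hS.continuousAt.eventually (by rw [hS1]; exact Units.isOpen.mem_nhds isUnit_one)
  have hinv_left : ∀ y, IsUnit (S y) → ∀ x, Ring.inverse (S y) (S y x) = x := fun y hy x =>
    DFunLike.congr_fun (Ring.inverse_mul_cancel _ hy) x
  have hinv_right : ∀ y, IsUnit (S y) → ∀ x, S y (Ring.inverse (S y) x) = x := fun y hy x =>
    DFunLike.congr_fun (Ring.mul_inverse_cancel _ hy) x
  obtain ⟨w, hw, hw0⟩ : ∃ w ∈ N y₁, w ≠ 0 := by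
    obtain ⟨y, ⟨w, hw, hFw⟩, hy⟩ :=
      ((mem_closure_iff_frequently.1 (interior_subset hy₁)).and_eventually hunit).exists
    refine ⟨S y w, hSN y w hFw, fun h0 => hw ?_⟩
    simpa [h0] using (hinv_left y hy w).symm
  refine ⟨y₁, fun y => Ring.inverse (S y) w, ?_, by simpa [hS1] using hw0, ?_⟩
  · have hinverse : ContinuousAt Ring.inverse (S y₁) := by
      rw [hS1]
      exact NormedRing.inverse_continuousAt 1
    exact (ContinuousAt.comp (f := S) hinverse hS.continuousAt).clm_apply continuousAt_const
  · filter_upwards [hunit, isOpen_interior.mem_nhds hy₁] with y hy hyO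
    have heq : N y = (N y₁).comap (S y : V →ₗ[𝕜] V) :=
      eq_comap_of_finrank_le (Function.LeftInverse.injective (hinv_left y hy)) (hSN y)
        (hmin y hyO)
    have hmem : Ring.inverse (S y) w ∈ N y := by
      rw [heq]
      simpa [hinv_right y hy] using hw
    exact hmem

end KernelSections

section ScalarProducts

theorem exists_orthogonal_apply_ne_zero {K V : Type*} [Field K] [AddCommGroup V] [Module K V]
    {b : LinearMap.BilinForm K V} (hsymm : b.IsSymm) (hnd : b.Nondegenerate)
    (hV : 3 ≤ Module.finrank K V) (w : V) : ∃ X Z, b X w = 0 ∧ b Z w = 0 ∧ b X Z ≠ 0 := by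
  have : FiniteDimensional K V := Module.finite_of_finrank_pos (by omega)
  by_contra! hcon
  let L : Submodule K V := Submodule.span K {w}
  have horth : ∀ X ∈ b.orthogonal L, b X w = 0 := fun X hX => by
    rw [← hsymm.eq]
    exact hX w (Submodule.mem_span_singleton_self w)
  have hle : b.orthogonal L ≤ b.orthogonal (b.orthogonal L) := fun X hX Z hZ =>
    hcon Z X (horth Z hZ) (horth X hX)
  have hfin := Submodule.finrank_mono hle
  have hLV : Module.finrank K L ≤ Module.finrank K V := Submodule.finrank_le L
  have hL : Module.finrank K L ≤ 1 := by simpa using finrank_span_le_card (R := K) ({w} : Set V)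
  simp only [LinearMap.BilinForm.finrank_orthogonal hnd] at hfin
  omega

theorem eq_top_of_forall_quadratic_mem {K V : Type*} [Field K] [NeZero (2 : K)] [AddCommGroup V]
    [Module K V] {b : LinearMap.BilinForm K V} (hsymm : b.IsSymm) (hnd : b.Nondegenerate)
    (hV : 3 ≤ Module.finrank K V) {w : V} (hw : w ≠ 0) {S : Submodule K V}
    (hS : ∀ X, b X w • X - (1 / 2 * b X X) • w ∈ S) : S = ⊤ := by
  have hpolar : ∀ X Z, b X w • Z + b Z w • X - b X Z • w ∈ S := fun X Z => by
    have h := S.sub_mem (S.sub_mem (hS (X + Z)) (hS X)) (hS Z)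
    convert! h using 1
    simp only [map_add, LinearMap.add_apply, ← hsymm.eq X Z]
    match_scalars <;> field_simp <;> ring
  have hwS : w ∈ S := by
    obtain ⟨X, Z, hX, hZ, hXZ⟩ := exists_orthogonal_apply_ne_zero hsymm hnd hV w
    have h := hpolar X Z
    rw [hX, hZ, zero_smul, zero_smul, add_zero, zero_sub, S.neg_mem_iff] at h
    exact (S.smul_mem_iff hXZ).1 h
  have hsum : ∀ X Z, b X w • Z + b Z w • X ∈ S := fun X Z => by
    simpa using S.add_mem (hpolar X Z) (S.smul_mem (b X Z) hwS)
  obtain ⟨X, hX⟩ : ∃ X, b X w ≠ 0 := by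
    by_contra! h
    exact hw (hnd.2 w h)
  have hXS : X ∈ S := by
    have h := hsum X X
    rw [← two_smul K (b X w • X)] at h
    exact (S.smul_mem_iff hX).1 ((S.smul_mem_iff two_ne_zero).1 h)
  refine eq_top_iff.2 fun Z _ => (S.smul_mem_iff hX).1 ?_
  simpa using S.sub_mem (hsum X Z) (S.smul_mem (b Z w) hXS)

end ScalarProducts

section ScalarProducts

variable {V W : Type*} [NormedAddCommGroup V] [NormedSpace ℝ V] [NormedAddCommGroup W]
  [NormedSpace ℝ W]

/-- Symmetric nondegenerate bilinear forms, of any signature. -/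
structure IsScalarProduct (h : V →L[ℝ] V →L[ℝ] ℝ) : Prop where
  symm : ∀ u v, h u v = h v u
  eq_zero : ∀ u, (∀ v, h u v = 0) → u = 0

namespace IsScalarProduct

variable {h : V →L[ℝ] V →L[ℝ] ℝ}

theorem ext (hh : IsScalarProduct h) {u v : V} (huv : ∀ w, h u w = h v w) : u = v :=
  sub_eq_zero.1 (hh.eq_zero _ fun w => by simp [huv])

theorem exists_apply_ne_zero (hh : IsScalarProduct h) {u : V} (hu : u ≠ 0) : ∃ v, h v u ≠ 0 := by
  by_contra! hcon
  exact hu (hh.eq_zero u fun v => (hh.symm u v).trans (hcon v))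

theorem isSymm (hh : IsScalarProduct h) : h.toBilinForm.IsSymm := ⟨hh.symm⟩

theorem nondegenerate (hh : IsScalarProduct h) : h.toBilinForm.Nondegenerate :=
  ⟨hh.eq_zero, fun u hu => hh.eq_zero u fun v => (hh.symm u v).trans (hu v)⟩

theorem isInvertible [FiniteDimensional ℝ V] (hh : IsScalarProduct h) : h.IsInvertible := by
  have hinj : Function.Injective (h : V →ₗ[ℝ] V →L[ℝ] ℝ) := fun u v huv =>
    hh.ext fun w => DFunLike.congr_fun huv w
  have hdim : Module.finrank ℝ V = Module.finrank ℝ (V →L[ℝ] ℝ) := by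
    rw [← (LinearMap.toContinuousLinearMap : (V →ₗ[ℝ] ℝ) ≃ₗ[ℝ] V →L[ℝ] ℝ).finrank_eq]
    exact (Subspace.dual_finrank_eq (K := ℝ) (V := V)).symm
  exact ⟨(LinearEquiv.ofInjectiveOfFinrankEq _ hinj hdim).toContinuousLinearEquiv, rfl⟩

theorem injective_of_isometry (hh : IsScalarProduct h) {h' : W →L[ℝ] W →L[ℝ] ℝ} {A : V →L[ℝ] W}
    (hA : ∀ u v, h' (A u) (A v) = h u v) : Function.Injective A := fun u v huv =>
  hh.ext fun w => by rw [← hA, huv, hA]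

end IsScalarProduct

/-- The endomorphism `a ∧ c : u ↦ h(a, u) c - h(c, u) a`, which is skew for `h`, as a function
of `a` and `c`. -/
def wedge (h : V →L[ℝ] V →L[ℝ] ℝ) : V →L[ℝ] V →L[ℝ] V →L[ℝ] V :=
  ContinuousLinearMap.smulRightL ℝ V V ∘L h - (ContinuousLinearMap.smulRightL ℝ V V ∘L h).flip

theorem wedge_apply (h : V →L[ℝ] V →L[ℝ] ℝ) (a c u : V) :
    wedge h a c u = h a u • c - h c u • a := rfl

theorem wedge_self (h : V →L[ℝ] V →L[ℝ] ℝ) (a : V) : wedge h a a = 0 := sub_self _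

theorem wedge_add_smul_self (h : V →L[ℝ] V →L[ℝ] ℝ) (a c : V) (r : ℝ) :
    wedge h a (r • a + c) = wedge h a c := by
  simp [wedge_self]

theorem symm_comp_wedge_comp {h : V →L[ℝ] V →L[ℝ] ℝ} {h' : W →L[ℝ] W →L[ℝ] ℝ} (P : V ≃L[ℝ] W)
    (hP : ∀ u v, h' (P u) (P v) = h u v) (a c : W) :
    (P.symm : W →L[ℝ] V) ∘L wedge h' a c ∘L (P : V →L[ℝ] W) =
      wedge h (P.symm a) (P.symm c) := by
  ext u
  simp [wedge_apply, ← hP]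

theorem eq_wedge_of_skew {h : V →L[ℝ] V →L[ℝ] ℝ} (hh : IsScalarProduct h) {A : V →L[ℝ] V}
    (hA : ∀ u v, h (A u) v = -h u (A v)) {s e : V} (hse : h s e = 1)
    (hAs : ∀ u v, h s u = 0 → h s v = 0 → h (A u) v = 0) : A = wedge h s (A e) := by
  have hAe : h (A e) e = 0 := by linarith [hA e e, hh.symm e (A e)]
  have hperp : ∀ u, h s (u - h s u • e) = 0 := fun u => by simp [hse]
  refine ContinuousLinearMap.ext fun u => hh.ext fun v => ?_
  have hmain := hAs _ _ (hperp u) (hperp v)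
  have hskew := hA u e
  rw [hh.symm u] at hskew
  simp only [map_sub, map_smul, sub_apply, smul_apply, smul_eq_mul, hAe, hskew] at hmain
  simp only [wedge_apply, map_sub, map_smul, sub_apply, smul_apply, smul_eq_mul]
  linarith

end ScalarProducts

section NullCone

variable {n : ℕ}

/-- The tractor metric `h` built from the scalar product `b` on `ℝⁿ`. -/
def tractorBil (b : Bil n) : Tractor n →L[ℝ] Tractor n →L[ℝ] ℝ :=
  (LinearMap.mk₂ ℝ (fun τ τ' : Tractor n => τ.1 * τ'.2.2 + τ'.1 * τ.2.2 + b τ.2.1 τ'.2.1)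
    (by intro a c d; simp; ring) (by intro r a c; simp; ring) (by intro a c d; simp; ring)
    (by intro r a c; simp; ring)).toContinuousBilinearMap

theorem tractorBil_apply (b : Bil n) (τ τ' : Tractor n) :
    tractorBil b τ τ' = τ.1 * τ'.2.2 + τ'.1 * τ.2.2 + b τ.2.1 τ'.2.1 := rfl

theorem IsScalarProduct.tractorBil {b : Bil n} (hb : IsScalarProduct b) :
    IsScalarProduct (tractorBil b) where
  symm τ τ' := by
    rw [tractorBil_apply, tractorBil_apply, hb.symm τ.2.1]
    ring
  eq_zero τ hτ := by
    have hmid : τ.2.1 = 0 := hb.eq_zero _ fun v => by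
      simpa [tractorBil_apply] using hτ (0, v, 0)
    exact Prod.ext (by simpa [tractorBil_apply] using hτ (0, 0, 1))
      (Prod.ext hmid (by simpa [tractorBil_apply] using hτ (1, 0, 0)))

theorem tractorBil_sMinus (b : Bil n) (τ : Tractor n) : tractorBil b (sMinus n) τ = τ.2.2 := by
  simp [tractorBil_apply, sMinus]

/-- Up to scaling, the null vectors not orthogonal to `s₊` are the `nullVec b y`. -/
def nullVec (b : Bil n) (y : E n) : Tractor n := (1, y, -(1 / 2) * b y y)

/-- The derivative of `nullVec b` at `y`. -/
def nullTangent (b : Bil n) (y : E n) : E n →L[ℝ] Tractor n :=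
  (0 : E n →L[ℝ] ℝ).prod ((ContinuousLinearMap.id ℝ (E n)).prod (-(b y)))

theorem nullTangent_apply (b : Bil n) (y w : E n) : nullTangent b y w = (0, w, -b y w) := rfl

theorem continuous_nullVec (b : Bil n) : Continuous (nullVec b) := by
  unfold nullVec
  fun_prop

theorem continuous_nullTangent (b : Bil n) : Continuous (nullTangent b) :=
  continuous_clm_apply.2 fun w => by
    simp only [nullTangent_apply]
    fun_prop

theorem nullVec_ne_zero (b : Bil n) (y : E n) : nullVec b y ≠ 0 := fun h =>
  one_ne_zero (congrArg Prod.fst h)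

theorem tractorBil_nullVec_self (b : Bil n) (y : E n) :
    tractorBil b (nullVec b y) (nullVec b y) = 0 := by
  simp [tractorBil_apply, nullVec]
  ring

theorem eq_smul_nullVec_add_nullTangent {b : Bil n} {y : E n} {u : Tractor n}
    (hu : tractorBil b (nullVec b y) u = 0) :
    u = u.1 • nullVec b y + nullTangent b y (u.2.1 - u.1 • y) := by
  obtain ⟨a, Z, c⟩ := u
  simp only [tractorBil_apply, nullVec] at hu
  refine Prod.ext (by simp [nullVec, nullTangent_apply])
    (Prod.ext (by simp [nullVec, nullTangent_apply]) ?_)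
  simp only [nullVec, nullTangent_apply, Prod.smul_mk, Prod.mk_add_mk, smul_eq_mul, map_sub (b y),
    map_smul (b y)]
  linarith

theorem eq_smul_nullVec {b : Bil n} {f : Tractor n} (hf : tractorBil b f f = 0) (h : f.1 ≠ 0) :
    f = f.1 • nullVec b (f.1⁻¹ • f.2.1) := by
  obtain ⟨a, Y, c⟩ := f
  rw [tractorBil_apply] at hf
  refine Prod.ext (by simp [nullVec]) (Prod.ext ?_ ?_)
  · simp [nullVec, smul_smul, mul_inv_cancel₀ (show a ≠ 0 from h)]
  · simp only [nullVec, Prod.smul_mk, smul_eq_mul, map_smul, smul_apply] at hf h ⊢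
    field_simp
    linarith

theorem exists_wedge_eq_smul_wedge_nullVec {b : Bil n} {f k : Tractor n}
    (hf : tractorBil b f f = 0) (h : f.1 ≠ 0) (hk : tractorBil b f k = 0)
    (hfk : ∀ r : ℝ, k ≠ r • f) :
    ∃ w ≠ 0, wedge (tractorBil b) f k = f.1 • wedge (tractorBil b)
      (nullVec b (f.1⁻¹ • f.2.1)) (nullTangent b (f.1⁻¹ • f.2.1) w) := by
  have hf' := eq_smul_nullVec hf h
  generalize f.1⁻¹ • f.2.1 = z at hf' ⊢
  generalize f.1 = α at hf' h ⊢
  have hk' : tractorBil b (nullVec b z) k = 0 := by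
    rw [hf', map_smul, smul_apply, smul_eq_mul] at hk
    exact (mul_eq_zero.1 hk).resolve_left h
  have hdec := eq_smul_nullVec_add_nullTangent hk'
  refine ⟨k.2.1 - k.1 • z, fun hw => hfk (k.1 * α⁻¹) ?_, ?_⟩
  · rw [hw, map_zero, add_zero] at hdec
    rwa [hf', smul_smul, mul_assoc, inv_mul_cancel₀ h, mul_one]
  · rw [hf', map_smul, smul_apply]
    congr 1
    conv_lhs => rw [hdec]
    exact wedge_add_smul_self _ _ _ _

theorem wedge_nullVec_line {b : Bil n} (hb : IsScalarProduct b) (y X w : E n) (t : ℝ) :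
    wedge (tractorBil b) (nullVec b (y + t • X)) (nullTangent b (y + t • X) w) (nullVec b y) =
      t • (b X w • nullVec b (y + t • X)
        - (1 / 2 * t * b X X) • nullTangent b (y + t • X) w) := by
  have hvec : tractorBil b (nullVec b (y + t • X)) (nullVec b y) = -(1 / 2) * t ^ 2 * b X X := by
    simp only [tractorBil_apply, nullVec, map_add, add_apply, map_smul, smul_apply, smul_eq_mul]
    rw [hb.symm X y]
    ring
  have htangent : tractorBil b (nullTangent b (y + t • X) w) (nullVec b y) = -(t * b X w) := by
    simp only [tractorBil_apply, nullTangent_apply, nullVec, map_add, add_apply, map_smul,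
      smul_apply, smul_eq_mul]
    rw [hb.symm w y]
    ring
  rw [wedge_apply, hvec, htangent]
  module

theorem nullVec_line_sub {b : Bil n} (hb : IsScalarProduct b) (y X : E n) (t : ℝ) :
    nullVec b (y + t • X) - nullVec b y =
      t • (nullTangent b y X + t • (0, 0, -(1 / 2) * b X X)) := by
  refine Prod.ext (by simp [nullVec, nullTangent_apply])
    (Prod.ext (by simp [nullVec, nullTangent_apply]) ?_)
  simp only [nullVec, nullTangent_apply, map_add, map_smul, add_apply, smul_apply, smul_eq_mul,
    Prod.mk_sub_mk, Prod.smul_mk, Prod.mk_add_mk, hb.symm X y]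
  ring

theorem continuousAt_line {V : Type*} [NormedAddCommGroup V] [NormedSpace ℝ V] (y X : V) :
    ContinuousAt (fun t : ℝ => y + t • X) 0 := by fun_prop

theorem continuousAt_comp_line {V W : Type*} [NormedAddCommGroup V] [NormedSpace ℝ V]
    [TopologicalSpace W] {κ : V → W} {y : V} (hκ : ContinuousAt κ y) (X : V) :
    ContinuousAt (fun t : ℝ => κ (y + t • X)) 0 :=
  ContinuousAt.comp (f := fun t : ℝ => y + t • X) (by simpa using hκ) (continuousAt_line y X)

/-- The directions in which the endomorphisms from `h` move `v`: the tangent space at `v` of the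
orbit of a group with Lie algebra `h`. -/
def orbitTangent (h : Submodule ℝ (Tractor n →L[ℝ] Tractor n)) (v : Tractor n) :
    Submodule ℝ (Tractor n) :=
  h.map (ContinuousLinearMap.apply ℝ (Tractor n) v : _ →ₗ[ℝ] Tractor n)

section Orbit

variable {b : Bil n} (hb : IsScalarProduct b) {h : Submodule ℝ (Tractor n →L[ℝ] Tractor n)}
  {y : E n} {κ : E n → E n} (hκ : ContinuousAt κ y)
  (hmem : ∀ᶠ z in 𝓝 y, wedge (tractorBil b) (nullVec b z) (nullTangent b z (κ z)) ∈ h)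
include hb

include hmem in
theorem eventually_line_mem_orbitTangent (X : E n) : ∀ᶠ t in 𝓝[≠] (0 : ℝ),
    b X (κ (y + t • X)) • nullVec b (y + t • X)
      - (1 / 2 * t * b X X) • nullTangent b (y + t • X) (κ (y + t • X)) ∈
        orbitTangent h (nullVec b y) := by
  have hline : Filter.Tendsto (fun t : ℝ => y + t • X) (𝓝 0) (𝓝 y) := by
    simpa using (continuousAt_line y X).tendsto
  filter_upwards [(hline.eventually hmem).filter_mono nhdsWithin_le_nhds, self_mem_nhdsWithin]
    with t ht ht0
  refine ((orbitTangent h (nullVec b y)).smul_mem_iff (show t ≠ 0 from ht0)).1 ?_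
  rw [← wedge_nullVec_line hb]
  exact ⟨_, ht, rfl⟩

include hκ hmem in
theorem nullVec_mem_orbitTangent (hκ0 : κ y ≠ 0) :
    nullVec b y ∈ orbitTangent h (nullVec b y) := by
  obtain ⟨X, hX⟩ := hb.exists_apply_ne_zero hκ0
  refine ((orbitTangent h (nullVec b y)).smul_mem_iff hX).1 ?_
  have hκX := continuousAt_comp_line hκ X
  have hvec := (continuous_nullVec b).continuousAt.comp (continuousAt_line y X)
  have htan := (continuous_nullTangent b).continuousAt.comp (continuousAt_line y X)
  have hcont : ContinuousAt (fun t : ℝ => b X (κ (y + t • X)) • nullVec b (y + t • X)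
      - (1 / 2 * t * b X X) • nullTangent b (y + t • X) (κ (y + t • X))) 0 :=
    (((b X).continuous.continuousAt.comp hκX).smul hvec).sub
      ((by fun_prop : ContinuousAt (fun t : ℝ => 1 / 2 * t * b X X) 0).smul
        (htan.clm_apply hκX))
  exact (Submodule.closed_of_finiteDimensional _).mem_of_tendsto
    (by simpa using hcont.tendsto.mono_left nhdsWithin_le_nhds)
    (eventually_line_mem_orbitTangent hb hmem X)

include hκ hmem in
theorem nullTangent_sub_mem_orbitTangent (hv : nullVec b y ∈ orbitTangent h (nullVec b y))
    (X : E n) : nullTangent b y (b X (κ y) • X - (1 / 2 * b X X) • κ y) ∈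
      orbitTangent h (nullVec b y) := by
  let f : ℝ → Tractor n := fun t =>
    b X (κ (y + t • X)) • (nullTangent b y X + t • ((0, 0, -(1 / 2) * b X X) : Tractor n))
      - (1 / 2 * b X X) • nullTangent b (y + t • X) (κ (y + t • X))
  have hκX := continuousAt_comp_line hκ X
  have htan := (continuous_nullTangent b).continuousAt.comp (continuousAt_line y X)
  have htanκ := htan.clm_apply hκX
  have hcont : ContinuousAt f 0 :=
    (((b X).continuous.continuousAt.comp hκX).smul (by fun_prop)).sub
      ((continuousAt_const (y := 1 / 2 * b X X)).smul htanκ)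
  have hf0 : f 0 = nullTangent b y (b X (κ y) • X - (1 / 2 * b X X) • κ y) := by
    rw [map_sub, map_smul, map_smul]
    simp [f]
  rw [← hf0]
  refine (Submodule.closed_of_finiteDimensional _).mem_of_tendsto (b := 𝓝[≠] (0 : ℝ))
    (hcont.tendsto.mono_left nhdsWithin_le_nhds) ?_
  filter_upwards [eventually_line_mem_orbitTangent hb hmem X, self_mem_nhdsWithin] with t ht ht0
  refine (Submodule.smul_mem_iff _ (show t ≠ 0 from ht0)).1 ?_
  convert! Submodule.sub_mem _ ht (Submodule.smul_mem _ (b X (κ (y + t • X))) hv) using 1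
  rw [sub_eq_iff_eq_add.1 (nullVec_line_sub hb y X t)]
  module

end Orbit

theorem exists_mem_orbitTangent_of_dense_wedge (hn : 3 ≤ n) {b : Bil n} (hb : IsScalarProduct b)
    (h : Submodule ℝ (Tractor n →L[ℝ] Tractor n))
    (hD : (interior (closure {y | ∃ w ≠ 0,
      wedge (tractorBil b) (nullVec b y) (nullTangent b y w) ∈ h})).Nonempty) :
    ∃ y, ∀ u, tractorBil b (nullVec b y) u = 0 → u ∈ orbitTangent h (nullVec b y) := by
  have hF : Continuous fun y => wedge (tractorBil b) (nullVec b y) ∘L nullTangent b y :=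
    ((wedge (tractorBil b)).continuous.comp (continuous_nullVec b)).clm_comp
      (continuous_nullTangent b)
  obtain ⟨y, κ, hκ, hκ0, hmem⟩ := exists_continuousAt_section_mem hF h hD
  have hv := nullVec_mem_orbitTangent hb hκ hmem hκ0
  have htop : (orbitTangent h (nullVec b y)).comap (nullTangent b y : E n →ₗ[ℝ] Tractor n) = ⊤ :=
    eq_top_of_forall_quadratic_mem hb.isSymm hb.nondegenerate (by simpa using hn) hκ0
      (nullTangent_sub_mem_orbitTangent hb hκ hmem hv)
  refine ⟨y, fun u hu => ?_⟩
  have htan : u.2.1 - u.1 • y ∈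
      (orbitTangent h (nullVec b y)).comap (nullTangent b y : E n →ₗ[ℝ] Tractor n) :=
    htop ▸ Submodule.mem_top
  rw [eq_smul_nullVec_add_nullTangent hu]
  exact Submodule.add_mem _ (Submodule.smul_mem _ _ hv) htan

end NullCone

section Velocities

/-- The velocities at time `0` of the smooth curves through `1` in a subset `H` of an algebra. -/
def velocities {R : Type*} [NormedRing R] [NormedAlgebra ℝ R] (H : Set R) : Set R :=
  {A | ∃ c : ℝ → R, ContDiff ℝ ∞ c ∧ (∀ t, c t ∈ H) ∧ c 0 = 1 ∧ HasDerivAt c A 0}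

variable {R : Type*} [NormedRing R] [NormedAlgebra ℝ R]

theorem map_mem_span_velocities {R' : Type*} [NormedRing R'] [NormedAlgebra ℝ R'] {H : Set R}
    {H' : Set R'} {φ : R →L[ℝ] R'} (hφ1 : φ 1 = 1) (hφ : MapsTo φ H H') {A : R}
    (hA : A ∈ Submodule.span ℝ (velocities H)) : φ A ∈ Submodule.span ℝ (velocities H') := by
  have hmap : MapsTo φ (velocities H) (velocities H') := fun A ⟨c, hsmooth, hc, hc0, hderiv⟩ =>
    ⟨fun t => φ (c t), φ.contDiff.comp hsmooth, fun t => hφ (hc t), by simp [hc0, hφ1],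
      φ.hasFDerivAt.comp_hasDerivAt 0 hderiv⟩
  have hle : Submodule.span ℝ (velocities H) ≤
      (Submodule.span ℝ (velocities H')).comap (φ : R →ₗ[ℝ] R') :=
    Submodule.span_le.2 fun A hA => Submodule.subset_span (hmap hA)
  exact hle hA

theorem skew_of_mem_span_velocities {V : Type*} [NormedAddCommGroup V] [NormedSpace ℝ V]
    {h : V →L[ℝ] V →L[ℝ] ℝ} {H : Set (V →L[ℝ] V)} (hH : ∀ a ∈ H, ∀ u v, h (a u) (a v) = h u v)
    {A : V →L[ℝ] V} (hA : A ∈ Submodule.span ℝ (velocities H)) (u v : V) :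
    h (A u) v = -h u (A v) := by
  induction hA using Submodule.span_induction with
  | mem A hA =>
    obtain ⟨c, -, hc, hc0, hderiv⟩ := hA
    have hcu (u : V) : HasDerivAt (fun t => c t u) (A u) 0 := by
      simpa using hderiv.clm_apply (hasDerivAt_const 0 u)
    have hprod := (h.hasFDerivAt.comp_hasDerivAt 0 (hcu u)).clm_apply (hcu v)
    have hconst := hprod.unique
      ((hasDerivAt_const 0 (h u v)).congr_of_eventuallyEq (.of_forall fun t => hH _ (hc t) u v))
    simp only [Function.comp_apply, hc0, one_apply_eq_self] at hconst
    linarith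
  | zero => simp
  | add A B _ _ hA hB => simp only [add_apply, map_add, hA, hB, neg_add]
  | smul r A _ hA => simp only [smul_apply, map_smul, hA, smul_neg]

theorem exists_hasStrictFDerivAt_prod {H : Submonoid R} {ι : Type*} [Finite ι] {A : ι → R}
    (hA : ∀ i, A i ∈ velocities (H : Set R)) (s : Finset ι) :
    ∃ Ψ : (ι → ℝ) → R, (∀ t, Ψ t ∈ H) ∧ Ψ 0 = 1 ∧ HasStrictFDerivAt Ψ
      (∑ i ∈ s, (ContinuousLinearMap.proj i : (ι → ℝ) →L[ℝ] ℝ).smulRight (A i)) 0 := by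
  classical
  cases nonempty_fintype ι
  choose c hsmooth hc hc0 hderiv using hA
  induction s using Finset.induction_on with
  | empty => exact ⟨fun _ => 1, fun _ => H.one_mem, rfl, by simpa using hasStrictFDerivAt_const _ _⟩
  | insert i s hi ih =>
    obtain ⟨Ψ, hΨ, hΨ0, hΨd⟩ := ih
    have hstrict := (hsmooth i).contDiffAt.hasStrictDerivAt' (hderiv i) (by simp)
    have hci : HasStrictFDerivAt (fun t : ι → ℝ => c i (t i))
        ((ContinuousLinearMap.proj i : (ι → ℝ) →L[ℝ] ℝ).smulRight (A i)) 0 :=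
      hstrict.hasStrictFDerivAt.comp (0 : ι → ℝ)
        (ContinuousLinearMap.proj i : (ι → ℝ) →L[ℝ] ℝ).hasStrictFDerivAt
    refine ⟨fun t => c i (t i) * Ψ t, fun t => H.mul_mem (hc i _) (hΨ t), by simp [hc0, hΨ0],
      (hci.mul' hΨd).congr_fderiv ?_⟩
    ext t
    simp [hc0, hΨ0, Finset.sum_insert hi, add_comm]

theorem eventually_exists_mem_apply_eq {F : Type*} [NormedAddCommGroup F] [NormedSpace ℝ F]
    [FiniteDimensional ℝ F] {H : Submonoid R} (L : R →L[ℝ] F)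
    (hL : Submodule.span ℝ (L '' velocities (H : Set R)) = ⊤) :
    ∀ᶠ z in 𝓝 (L 1), ∃ a ∈ H, L a = z := by
  let B := Module.Basis.ofSpan hL.ge
  have : Fintype ((linearIndepOn_empty ℝ (id : F → F)).extend (empty_subset (L '' _))) :=
    Module.Basis.fintypeIndexOfRankLtAleph0 B (Module.rank_lt_aleph0 _ _)
  have hB : ∀ i, B i ∈ L '' velocities (H : Set R) :=
    fun i => Module.Basis.ofSpan_subset hL.ge ⟨i, rfl⟩
  choose A hA hAB using hB
  obtain ⟨Ψ, hΨ, hΨ0, hΨd⟩ := exists_hasStrictFDerivAt_prod hA Finset.univ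
  have hmap := (L.hasStrictFDerivAt.comp 0 hΨd).map_nhds_eq_of_surj <| by
    rw [LinearMap.range_eq_top]
    refine fun z => ⟨B.equivFun z, ?_⟩
    conv_rhs => rw [← B.sum_equivFun z]
    simp [hAB]
  rw [hΨ0] at hmap
  rw [← hmap, Filter.eventually_map]
  exact Filter.Eventually.of_forall fun t => ⟨Ψ t, hΨ t, rfl⟩

end Velocities

section Primitive

open scoped unitInterval

variable {F : Type*} [NormedAddCommGroup F] [NormedSpace ℝ F]

/-- The Volterra operator `f ↦ (t ↦ ∫₀ᵗ f)` on `C([0, 1], F)`. -/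
def primitive : C(I, F) →L[ℝ] C(I, F) :=
  LinearMap.mkContinuous
    { toFun := fun f => ⟨fun t => ∫ s in (0 : ℝ)..t, IccExtend zero_le_one f s,
        (intervalIntegral.continuous_primitive
          (fun _ _ => f.continuous.Icc_extend'.intervalIntegrable _ _) 0).comp
          continuous_subtype_val⟩
      map_add' := fun f f' => by
        ext t
        exact intervalIntegral.integral_add (f.continuous.Icc_extend'.intervalIntegrable _ _)
          (f'.continuous.Icc_extend'.intervalIntegrable _ _)
      map_smul' := fun c f => by
        ext t
        exact intervalIntegral.integral_smul c (IccExtend zero_le_one f) }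
    1 fun f => by
      rw [ContinuousMap.norm_le _ (by positivity)]
      intro t
      refine (intervalIntegral.norm_integral_le_of_norm_le_const
        fun s _ => f.norm_coe_le_norm _).trans ?_
      rw [sub_zero, abs_of_nonneg t.2.1, one_mul]
      exact mul_le_of_le_one_right (norm_nonneg f) t.2.2

theorem primitive_apply (f : C(I, F)) (t : I) :
    primitive f t = ∫ s in (0 : ℝ)..t, IccExtend zero_le_one f s := rfl

theorem primitive_const [CompleteSpace F] (c : F) (t : I) :
    primitive (ContinuousMap.const I c) t = (t : ℝ) • c :=
  (intervalIntegral.integral_const c).trans (by rw [sub_zero])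

theorem hasDerivWithinAt_IccExtend_primitive [CompleteSpace F] (f : C(I, F)) {t : ℝ}
    (ht : t ∈ Icc (0 : ℝ) 1) :
    HasDerivWithinAt (IccExtend zero_le_one (primitive f)) (IccExtend zero_le_one f t)
      (Icc 0 1) t := by
  have hf : Continuous (IccExtend zero_le_one f) := f.continuous.Icc_extend'
  refine (hf.integral_hasStrictDerivAt 0 t).hasDerivAt.hasDerivWithinAt.congr (fun s hs => ?_) ?_
  · rw [IccExtend_of_mem _ _ hs, primitive_apply]
  · rw [IccExtend_of_mem _ _ ht, primitive_apply]

end Primitive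

section Segments

variable {V W : Type*} [NormedAddCommGroup V] [NormedSpace ℝ V] [NormedAddCommGroup W]
  [NormedSpace ℝ W]

theorem add_smul_mem_ball {y₀ ξ : V} {r t : ℝ} (hξ : ‖ξ‖ < r) (ht : t ∈ Icc (0 : ℝ) 1) :
    y₀ + t • ξ ∈ Metric.ball y₀ r := by
  rw [mem_ball_iff_norm, add_sub_cancel_left, norm_smul, Real.norm_of_nonneg ht.1]
  exact (mul_le_of_le_one_left (norm_nonneg ξ) ht.2).trans_lt hξ

theorem norm_segment_sub_le {B : V → V →L[ℝ] W} {y₀ ξ η : V} {r t : ℝ} {L : NNReal}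
    (hL : LipschitzOnWith L B (Metric.ball y₀ r)) (hξ : ‖ξ‖ < r) (hη : ‖η‖ < r)
    (ht : t ∈ Icc (0 : ℝ) 1) :
    ‖B (y₀ + t • ξ) ξ - B (y₀ + t • η) η - B y₀ (ξ - η)‖ ≤ L * (‖ξ‖ + ‖η‖) * ‖ξ - η‖ := by
  have hlip {ξ' η' : V} (hξ' : ‖ξ'‖ < r) (hη' : ‖η'‖ < r) (ζ : V) :
      ‖(B (y₀ + t • ξ') - B (y₀ + t • η')) ζ‖ ≤ L * ‖ξ' - η'‖ * ‖ζ‖ := by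
    refine ContinuousLinearMap.le_of_opNorm_le _ ?_ ζ
    have h := hL.norm_sub_le (add_smul_mem_ball hξ' ht) (add_smul_mem_ball hη' ht)
    rw [add_sub_add_left_eq_sub, ← smul_sub, norm_smul, Real.norm_of_nonneg ht.1] at h
    refine h.trans ?_
    gcongr
    exact mul_le_of_le_one_left (norm_nonneg _) ht.2
  have h0 : ‖(0 : V)‖ < r := norm_zero.trans_lt ((norm_nonneg ξ).trans_lt hξ)
  calc ‖B (y₀ + t • ξ) ξ - B (y₀ + t • η) η - B y₀ (ξ - η)‖
      = ‖(B (y₀ + t • ξ) - B (y₀ + t • (0 : V))) (ξ - η)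
          + (B (y₀ + t • ξ) - B (y₀ + t • η)) η‖ := by
        congr 1
        simp only [sub_apply, map_sub, smul_zero, add_zero]
        abel
    _ ≤ L * ‖ξ - 0‖ * ‖ξ - η‖ + L * ‖ξ - η‖ * ‖η‖ :=
        (norm_add_le _ _).trans (add_le_add (hlip hξ h0 _) (hlip hξ hη _))
    _ = L * (‖ξ‖ + ‖η‖) * ‖ξ - η‖ := by
        rw [sub_zero]
        ring

end Segments

section LinearODE

open scoped unitInterval

variable {V R : Type*} [NormedAddCommGroup V] [NormedSpace ℝ V] [NormedRing R] [NormedAlgebra ℝ R]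

theorem hasStrictFDerivAt_ringInverse_of_eq_one [CompleteSpace R] {u : V → R} {u' : V →L[ℝ] R}
    {x : V} (hu : HasStrictFDerivAt u u' x) (hx : u x = 1) :
    HasStrictFDerivAt (fun y => Ring.inverse (u y)) (-u') x := by
  have hinv : HasStrictFDerivAt (Ring.inverse : R → R)
      (-ContinuousLinearMap.mulLeftRight ℝ R 1 1) (u x) := by
    rw [hx]
    simpa using hasStrictFDerivAt_ringInverse (𝕜 := ℝ) (1 : Rˣ)
  refine (hinv.comp x hu).congr_fderiv ?_
  ext v
  simp

theorem hasStrictFDerivAt_ringInverse_one_add_apply {X : Type*} [NormedAddCommGroup X]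
    [NormedSpace ℝ X] [CompleteSpace X] (K : V →L[ℝ] X →L[ℝ] X) (x : X) :
    HasStrictFDerivAt (fun a => Ring.inverse (1 + K a) x) (-K.flip x) 0 := by
  have hK : HasStrictFDerivAt (fun a => 1 + K a) K 0 := K.hasStrictFDerivAt.const_add 1
  refine ((hasStrictFDerivAt_ringInverse_of_eq_one hK (by simp)).clm_apply
    (hasStrictFDerivAt_const x 0)).congr_fderiv ?_
  ext a
  simp

/-- The Volterra operator `u ↦ (t ↦ ∫₀ᵗ a u)` with kernel `a`, as a linear function of `a`. -/
def volterra : C(I, R) →L[ℝ] C(I, R) →L[ℝ] C(I, R) :=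
  ContinuousLinearMap.compL ℝ _ _ _ primitive ∘L ContinuousLinearMap.mul ℝ C(I, R)

theorem volterra_apply (a u : C(I, R)) : volterra a u = primitive (a * u) := rfl

/-- The solution `U` of `U' = -a U`, `U(0) = 1` on `[0, 1]`, for small coefficients `a`: it solves
the Volterra equation `U + ∫₀ᵗ a U = 1`, whose left hand side is invertible near `a = 0`. -/
def linearSolution (a : C(I, R)) : C(I, R) :=
  Ring.inverse (1 + volterra a) 1

/-- Along short segments, `B(y₀ + tξ)(ξ)` is a continuous function of `t ∈ [0, 1]` which depends on
`ξ` in a strictly differentiable way. -/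
theorem exists_segment_coefficients {B : V → V →L[ℝ] R} {y₀ : V} (hB : ContDiffAt ℝ 1 B y₀) :
    ∃ a : V → C(I, R), (∀ᶠ ξ in 𝓝 0, ∀ t, a ξ t = B (y₀ + (t : ℝ) • ξ) ξ) ∧
      HasStrictFDerivAt a (ContinuousLinearMap.const ℝ I ∘L B y₀) 0 := by
  obtain ⟨L, s, hs, hLs⟩ := hB.exists_lipschitzOnWith
  obtain ⟨r, hr, hball⟩ := Metric.mem_nhds_iff.1 hs
  have hL := hLs.mono hball
  have hcont : ∀ᶠ ξ in 𝓝 (0 : V), ∃ f : C(I, R), ∀ t, f t = B (y₀ + (t : ℝ) • ξ) ξ := by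
    filter_upwards [Metric.ball_mem_nhds 0 hr] with ξ hξ
    have hc : Continuous fun t : I => B (y₀ + (t : ℝ) • ξ) :=
      hL.continuousOn.comp_continuous (by fun_prop)
        fun t => add_smul_mem_ball (mem_ball_zero_iff.1 hξ) t.2
    exact ⟨⟨fun t => B (y₀ + (t : ℝ) • ξ) ξ, hc.clm_apply continuous_const⟩, fun _ => rfl⟩
  obtain ⟨a, ha⟩ := hcont.choice
  refine ⟨a, ha, hasStrictFDerivAt_iff_isLittleO.2 (Asymptotics.isLittleO_iff.2 fun c hc => ?_)⟩
  have hsmall : ∀ᶠ z : V × V in 𝓝 (0, 0), L * (‖z.1‖ + ‖z.2‖) < c := by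
    have : Continuous fun z : V × V => L * (‖z.1‖ + ‖z.2‖) := by fun_prop
    exact this.continuousAt.eventually (Iio_mem_nhds (by simpa using hc))
  have hnear := ha.and (Filter.eventually_mem_set.2 (Metric.ball_mem_nhds (0 : V) hr))
  filter_upwards [hsmall, hnear.prodMk_nhds hnear] with z hz ⟨⟨hξ, hξr⟩, hη, hηr⟩
  rw [ContinuousMap.norm_le _ (by positivity)]
  intro t
  rw [mem_ball_zero_iff] at hξr hηr
  calc ‖a z.1 t - a z.2 t - B y₀ (z.1 - z.2)‖
      = ‖B (y₀ + (t : ℝ) • z.1) z.1 - B (y₀ + (t : ℝ) • z.2) z.2 - B y₀ (z.1 - z.2)‖ := by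
        rw [hξ, hη]
    _ ≤ L * (‖z.1‖ + ‖z.2‖) * ‖z.1 - z.2‖ := norm_segment_sub_le hL hξr hηr t.2
    _ ≤ c * ‖z.1 - z.2‖ := by gcongr

variable [CompleteSpace R]

theorem eventually_linearSolution_eq :
    ∀ᶠ a : C(I, R) in 𝓝 0, linearSolution a = 1 - primitive (a * linearSolution a) := by
  have hcont : Continuous fun a : C(I, R) => 1 + volterra a := by fun_prop
  have hunit := hcont.continuousAt.eventually
    (Units.isOpen.mem_nhds (by simp : IsUnit (1 + volterra (0 : C(I, R)))))
  filter_upwards [hunit] with a ha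
  exact eq_sub_of_add_eq (DFunLike.congr_fun (Ring.mul_inverse_cancel _ ha) 1)

theorem hasStrictFDerivAt_linearSolution :
    HasStrictFDerivAt (linearSolution (R := R)) (-primitive) 0 := by
  have hflip : volterra.flip (1 : C(I, R)) = primitive := by
    ext a : 1
    rw [ContinuousLinearMap.flip_apply, volterra_apply, mul_one]
  have h := hasStrictFDerivAt_ringInverse_one_add_apply (volterra (R := R)) 1
  rwa [hflip] at h

/-- `U` is the fundamental solution of `U' = -B(y₀ + tξ)(ξ) U` on `[0, 1]`. -/
def IsFundamental (B : V → V →L[ℝ] R) (y₀ ξ : V) (U : ℝ → R) : Prop :=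
  U 0 = 1 ∧ ∀ t ∈ Icc (0 : ℝ) 1,
    HasDerivWithinAt U (-(B (y₀ + t • ξ) ξ) * U t) (Icc 0 1) t

theorem isFundamental_IccExtend {B : V → V →L[ℝ] R} {y₀ ξ : V} {a U : C(I, R)}
    (ha : ∀ t : I, a t = B (y₀ + (t : ℝ) • ξ) ξ) (hU : U = 1 - primitive (a * U)) :
    IsFundamental B y₀ ξ (IccExtend zero_le_one U) := by
  have hUt (t : I) : U t = 1 - primitive (a * U) t := DFunLike.congr_fun hU t
  refine ⟨?_, fun t ht => ?_⟩
  · rw [IccExtend_of_mem _ _ (left_mem_Icc.2 zero_le_one), hUt, primitive_apply]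
    simp
  · have h := (hasDerivWithinAt_IccExtend_primitive (a * U) ht).const_sub 1
    rw [IccExtend_of_mem _ _ ht] at h ⊢
    rw [neg_mul, ← ha ⟨t, ht⟩]
    exact h.congr (fun _ _ => hUt _) (hUt _)

theorem exists_fundamental_family {B : V → V →L[ℝ] R} {y₀ : V} (hB : ContDiffAt ℝ 1 B y₀) :
    ∃ U : V → ℝ → R, (∀ᶠ ξ in 𝓝 0, IsFundamental B y₀ ξ (U ξ)) ∧
      HasStrictFDerivAt (fun ξ => U ξ 1) (-(B y₀)) 0 := by
  obtain ⟨a, ha, hderiv⟩ := exists_segment_coefficients hB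
  have ha0 : a 0 = 0 := by
    ext t
    simp [ha.self_of_nhds]
  refine ⟨fun ξ => IccExtend zero_le_one (linearSolution (a ξ)), ?_, ?_⟩
  · have hev := hderiv.continuousAt.eventually (ha0 ▸ eventually_linearSolution_eq)
    filter_upwards [ha, hev] with ξ hξ hUξ using isFundamental_IccExtend hξ hUξ
  · have hsol : HasStrictFDerivAt linearSolution (-primitive) (a 0) :=
      ha0 ▸ hasStrictFDerivAt_linearSolution
    have heval := (ContinuousMap.evalCLM ℝ (1 : I)).hasStrictFDerivAt.comp 0 (hsol.comp 0 hderiv)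
    refine (heval.congr_of_eventuallyEq (.of_forall fun ξ => ?_)).congr_fderiv ?_
    · exact (IccExtend_of_mem _ _ (right_mem_Icc.2 zero_le_one)).symm
    · ext ξ
      exact (congrArg Neg.neg (primitive_const (B y₀ ξ) 1)).trans (by simp)

end LinearODE

/-- `G` is a smooth semi-Riemannian metric, of any signature, on the open set `s`. -/
structure IsMetricOn {n : ℕ} (G : E n → Bil n) (s : Set (E n)) : Prop where
  isOpen : IsOpen s
  smooth : ContDiffOn ℝ ∞ G s
  isScalarProduct : ∀ y ∈ s, IsScalarProduct (G y)

section Connection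

variable {n : ℕ} {G : E n → Bil n} {s : Set (E n)} {y : E n}

/-- The Christoffel symbols as a bilinear map. -/
def christoffelBil (G : E n → Bil n) (y : E n) : E n →L[ℝ] E n →L[ℝ] E n :=
  ContinuousLinearMap.compL ℝ (E n) (E n →L[ℝ] ℝ) (E n) (G y).inverse ∘L
    ((1 / 2 : ℝ) • (fderiv ℝ G y + (fderiv ℝ G y).flip -
      (ContinuousLinearMap.flipₗᵢ ℝ (E n) (E n) ℝ : _ →L[ℝ] _) ∘L (fderiv ℝ G y).flip))

theorem christoffelBil_apply (u v : E n) : christoffelBil G y u v = christoffel G y u v := rfl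

theorem IsMetricOn.apply_sharp (h : IsMetricOn G s) (hy : y ∈ s) (θ : E n →L[ℝ] ℝ) :
    G y (sharp G y θ) = θ :=
  (h.isScalarProduct y hy).isInvertible.self_apply_inverse θ

theorem IsMetricOn.differentiableAt (h : IsMetricOn G s) (hy : y ∈ s) :
    DifferentiableAt ℝ G y :=
  (h.smooth.contDiffAt (h.isOpen.mem_nhds hy)).differentiableAt (by simp)

theorem IsMetricOn.contDiffOn_apply (h : IsMetricOn G s) (u v : E n) :
    ContDiffOn ℝ ∞ (fun y => G y u v) s :=
  (h.smooth.clm_apply contDiffOn_const).clm_apply contDiffOn_const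

theorem IsMetricOn.contDiffOn_sharp (h : IsMetricOn G s) {θ : E n → E n →L[ℝ] ℝ}
    (hθ : ContDiffOn ℝ ∞ θ s) : ContDiffOn ℝ ∞ (fun y => sharp G y (θ y)) s :=
  ContDiffOn.clm_apply (fun y hy =>
    (h.isScalarProduct y hy).isInvertible.contDiffAt_map_inverse.comp_contDiffWithinAt y
      (h.smooth y hy)) hθ

theorem IsMetricOn.contDiffOn_christoffelBil (h : IsMetricOn G s) :
    ContDiffOn ℝ ∞ (christoffelBil G) s := by
  have hG : ContDiffOn ℝ ∞ (fderiv ℝ G) s := h.smooth.fderiv_of_isOpen h.isOpen (by simp)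
  have hGuv (u v : E n) : ContDiffOn ℝ ∞ (fun y => fderiv ℝ G y u v) s :=
    (hG.clm_apply contDiffOn_const).clm_apply contDiffOn_const
  refine contDiffOn_clm_apply.2 fun u => contDiffOn_clm_apply.2 fun v => ?_
  change ContDiffOn ℝ ∞ (fun y => christoffel G y u v) s
  refine h.contDiffOn_sharp (ContDiffOn.const_smul _ (((hGuv u v).add (hGuv v u)).sub ?_))
  exact contDiffOn_clm_apply.2 fun w => (hGuv w u).clm_apply contDiffOn_const

theorem IsMetricOn.differentiableAt_christoffelBil (h : IsMetricOn G s) (hy : y ∈ s) :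
    DifferentiableAt ℝ (christoffelBil G) y :=
  (h.contDiffOn_christoffelBil.contDiffAt (h.isOpen.mem_nhds hy)).differentiableAt (by simp)

theorem IsMetricOn.two_mul_apply_christoffel (h : IsMetricOn G s) (hy : y ∈ s) (u v w : E n) :
    2 * G y (christoffel G y u v) w =
      fderiv ℝ G y u v w + fderiv ℝ G y v u w - fderiv ℝ G y w u v := by
  rw [christoffel, h.apply_sharp hy]
  simp

theorem fderiv_clm_apply₂ {F F₁ F₂ F₃ : Type*} [NormedAddCommGroup F] [NormedSpace ℝ F]
    [NormedAddCommGroup F₁] [NormedSpace ℝ F₁] [NormedAddCommGroup F₂] [NormedSpace ℝ F₂]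
    [NormedAddCommGroup F₃] [NormedSpace ℝ F₃] {B : F → F₁ →L[ℝ] F₂ →L[ℝ] F₃} {y : F}
    (hB : DifferentiableAt ℝ B y) (u : F) (v : F₁) (w : F₂) :
    fderiv ℝ (fun z => B z v w) y u = fderiv ℝ B y u v w := by
  rw [((hB.hasFDerivAt.clm_apply (hasFDerivAt_const v y)).clm_apply
    (hasFDerivAt_const w y)).fderiv]
  simp

theorem IsMetricOn.fderiv_symm (h : IsMetricOn G s) (hy : y ∈ s) (u v w : E n) :
    fderiv ℝ G y u v w = fderiv ℝ G y u w v := by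
  have hsymm : (fun z => G z v w) =ᶠ[𝓝 y] fun z => G z w v := by
    filter_upwards [h.isOpen.mem_nhds hy] with z hz using (h.isScalarProduct z hz).symm v w
  rw [← fderiv_clm_apply₂ (h.differentiableAt hy), ← fderiv_clm_apply₂ (h.differentiableAt hy),
    hsymm.fderiv_eq]

theorem IsMetricOn.fderiv_eq_apply_christoffel (h : IsMetricOn G s) (hy : y ∈ s) (u v w : E n) :
    fderiv ℝ G y u v w = G y (christoffel G y u v) w + G y v (christoffel G y u w) := by
  have hvw := h.two_mul_apply_christoffel hy u v w
  have hwv := h.two_mul_apply_christoffel hy u w v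
  rw [(h.isScalarProduct y hy).symm _ v] at hwv
  linarith [h.fderiv_symm hy u v w, h.fderiv_symm hy v u w, h.fderiv_symm hy w u v]

end Connection

section Curvature

variable {n : ℕ} {G : E n → Bil n} {s : Set (E n)} {y : E n}

/-- The curvature as a trilinear map, at points where `G` is smooth and nondegenerate; in terms
of `T u v w = (∂ᵤ Γ)(v, w) + Γ(u, Γ(v, w))` it is `T u v w - T v u w`. -/
def curvatureForm (G : E n → Bil n) (y : E n) : E n →L[ℝ] E n →L[ℝ] E n →L[ℝ] E n :=
  let T := fderiv ℝ (christoffelBil G) y +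
    (ContinuousLinearMap.compL ℝ (E n) (E n) (E n)).bilinearComp
      (christoffelBil G y) (christoffelBil G y)
  T - T.flip

/-- The Ricci tensor as a bilinear form, at points where `G` is smooth and nondegenerate. -/
def ricciBil (G : E n → Bil n) (y : E n) : Bil n :=
  ∑ i, ContinuousLinearMap.compL ℝ (E n) (E n) ℝ (EuclideanSpace.proj i) ∘L
    curvatureForm G y (ebasis i)

/-- The Schouten tensor as a bilinear form, at points where `G` is smooth and nondegenerate. -/
def schoutenBil (G : E n → Bil n) (y : E n) : Bil n :=
  (1 / ((n : ℝ) - 2)) • (ricciBil G y - (scalarCurv G y / (2 * ((n : ℝ) - 1))) • G y)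

theorem curvatureForm_apply (u v w : E n) :
    curvatureForm G y u v w =
      fderiv ℝ (christoffelBil G) y u v w - fderiv ℝ (christoffelBil G) y v u w
      + christoffelBil G y u (christoffelBil G y v w)
      - christoffelBil G y v (christoffelBil G y u w) := by
  simp [curvatureForm]
  abel

theorem IsMetricOn.curvature_eq (h : IsMetricOn G s) (hy : y ∈ s) (u v w : E n) :
    curvature G y u v w = curvatureForm G y u v w := by
  rw [curvatureForm_apply, curvature]
  simp only [← christoffelBil_apply]
  rw [fderiv_clm_apply₂ (h.differentiableAt_christoffelBil hy),
    fderiv_clm_apply₂ (h.differentiableAt_christoffelBil hy)]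

theorem IsMetricOn.ricci_eq (h : IsMetricOn G s) (hy : y ∈ s) (v w : E n) :
    ricci G y v w = ricciBil G y v w := by
  simp [ricci, ricciBil, sum_apply, h.curvature_eq hy]

theorem IsMetricOn.schouten_eq (h : IsMetricOn G s) (hy : y ∈ s) (v w : E n) :
    schouten G y v w = schoutenBil G y v w := by
  simp [schouten, schoutenBil, h.ricci_eq hy]

theorem sum_coord_smul_ebasis (v : E n) : ∑ i, v i • ebasis i = v := by
  ext j
  simp [ebasis, Pi.single_apply]

theorem IsMetricOn.schoutenEnd_eq (h : IsMetricOn G s) (hy : y ∈ s) (v : E n) :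
    schoutenEnd G y v = sharp G y (schoutenBil G y v) := by
  have hcoord : ∑ i, schoutenBil G y v (ebasis i) • (EuclideanSpace.proj i : E n →L[ℝ] ℝ) =
      schoutenBil G y v := by
    ext w
    conv_rhs => rw [← sum_coord_smul_ebasis w]
    simp [sum_apply, mul_comm]
  rw [schoutenEnd, sharp, ← hcoord, map_sum]
  simp only [h.schouten_eq hy, map_smul]
  rfl

theorem IsMetricOn.contDiffOn_curvatureForm (h : IsMetricOn G s) :
    ContDiffOn ℝ ∞ (curvatureForm G) s := by
  have hΓ := h.contDiffOn_christoffelBil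
  have hΓ' : ContDiffOn ℝ ∞ (fderiv ℝ (christoffelBil G)) s :=
    hΓ.fderiv_of_isOpen h.isOpen (by simp)
  have hΓa (a : E n) : ContDiffOn ℝ ∞ (fun y => christoffelBil G y a) s :=
    hΓ.clm_apply contDiffOn_const
  have hΓab (a b : E n) : ContDiffOn ℝ ∞ (fun y => christoffelBil G y a b) s :=
    (hΓa a).clm_apply contDiffOn_const
  have hΓ'abc (a b c : E n) :
      ContDiffOn ℝ ∞ (fun y => fderiv ℝ (christoffelBil G) y a b c) s :=
    ((hΓ'.clm_apply contDiffOn_const).clm_apply contDiffOn_const).clm_apply contDiffOn_const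
  refine contDiffOn_clm_apply.2 fun u => contDiffOn_clm_apply.2 fun v =>
    contDiffOn_clm_apply.2 fun w => ?_
  simp only [curvatureForm_apply]
  exact (((hΓ'abc u v w).sub (hΓ'abc v u w)).add ((hΓa u).clm_apply (hΓab v w))).sub
    ((hΓa v).clm_apply (hΓab u w))

theorem IsMetricOn.contDiffOn_ricciBil (h : IsMetricOn G s) : ContDiffOn ℝ ∞ (ricciBil G) s :=
  ContDiffOn.sum fun _ _ => contDiffOn_const.clm_comp
    (h.contDiffOn_curvatureForm.clm_apply contDiffOn_const)

theorem IsMetricOn.contDiffOn_scalarCurv (h : IsMetricOn G s) :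
    ContDiffOn ℝ ∞ (scalarCurv G) s := by
  refine ContDiffOn.sum fun i _ => ContDiffOn.congr ?_ fun y hy => h.ricci_eq hy _ _
  exact (h.contDiffOn_ricciBil.clm_apply (h.contDiffOn_sharp contDiffOn_const)).clm_apply
    contDiffOn_const

theorem IsMetricOn.contDiffOn_schoutenBil (h : IsMetricOn G s) :
    ContDiffOn ℝ ∞ (schoutenBil G) s :=
  (h.contDiffOn_ricciBil.sub
    ((h.contDiffOn_scalarCurv.div_const _).smul h.smooth)).const_smul _

end Curvature

section TractorForm

variable {n : ℕ} {G : E n → Bil n} {s : Set (E n)} {y : E n}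

/-- The connection form of the tractor connection in coordinates: `∇_X τ = ∂_X τ + B(X) τ`. -/
def tractorForm (G : E n → Bil n) (y : E n) : E n →L[ℝ] Tractor n →L[ℝ] Tractor n :=
  (LinearMap.mk₂ ℝ (fun X τ => (-schoutenBil G y X τ.2.1,
      christoffelBil G y X τ.2.1 + τ.1 • X + τ.2.2 • sharp G y (schoutenBil G y X),
      -G y X τ.2.1))
    (fun X X' τ => by ext <;> simp [sharp] <;> ring)
    (fun r X τ => by ext <;> simp [sharp]; ring)
    (fun X τ τ' => by ext <;> simp <;> ring)
    (fun r X τ => by ext <;> simp; ring)).toContinuousBilinearMap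

theorem tractorForm_apply (X : E n) (τ : Tractor n) :
    tractorForm G y X τ = (-schoutenBil G y X τ.2.1,
      christoffelBil G y X τ.2.1 + τ.1 • X + τ.2.2 • sharp G y (schoutenBil G y X),
      -G y X τ.2.1) := rfl

theorem tractorForm_sMinus (X : E n) : tractorForm G y X (sMinus n) = (0, X, 0) := by
  simp [tractorForm_apply, sMinus]

theorem IsMetricOn.contDiffOn_tractorForm (h : IsMetricOn G s) :
    ContDiffOn ℝ ∞ (tractorForm G) s := by
  have hP (X : E n) : ContDiffOn ℝ ∞ (fun y => schoutenBil G y X) s :=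
    h.contDiffOn_schoutenBil.clm_apply contDiffOn_const
  refine contDiffOn_clm_apply.2 fun X => contDiffOn_clm_apply.2 fun τ => ?_
  simp only [tractorForm_apply]
  refine ((hP X).clm_apply contDiffOn_const).neg.prodMk (ContDiffOn.prodMk ?_
    (h.contDiffOn_apply _ _).neg)
  exact (((h.contDiffOn_christoffelBil.clm_apply contDiffOn_const).clm_apply
    contDiffOn_const).add contDiffOn_const).add ((h.contDiffOn_sharp (hP X)).const_smul _)

theorem IsMetricOn.tractorBil_tractorForm (h : IsMetricOn G s) (hy : y ∈ s) (X : E n)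
    (τ τ' : Tractor n) :
    tractorBil (G y) (tractorForm G y X τ) τ' + tractorBil (G y) τ (tractorForm G y X τ') =
      fderiv ℝ G y X τ.2.1 τ'.2.1 := by
  have hsymm := (h.isScalarProduct y hy).symm
  simp only [tractorBil_apply, tractorForm_apply, map_add, add_apply, map_smul, smul_apply,
    h.apply_sharp hy, hsymm τ.2.1 (sharp _ _ _), h.fderiv_eq_apply_christoffel hy,
    christoffelBil_apply, smul_eq_mul, hsymm τ.2.1 X]
  ring

end TractorForm

theorem two_le_infty : (2 : WithTop ℕ∞) ≤ ∞ :=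
  WithTop.coe_le_coe.2 le_top

section Pullback

variable {n : ℕ} {φ : E n → E n} {G G' : E n → Bil n} {s s' : Set (E n)} {y : E n}

/-- `φ : s → s'` is a local isometry: the metric `G` on `s` is the pullback of the metric `G'`
on `s'`. -/
structure IsPullback (φ : E n → E n) (G : E n → Bil n) (s : Set (E n)) (G' : E n → Bil n)
    (s' : Set (E n)) : Prop where
  source : IsMetricOn G s
  target : IsMetricOn G' s'
  smooth : ContDiffOn ℝ ∞ φ s
  mapsTo : MapsTo φ s s'
  eq : ∀ y ∈ s, ∀ u v, G y u v = G' (φ y) (fderiv ℝ φ y u) (fderiv ℝ φ y v)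

namespace IsPullback

theorem contDiffAt (h : IsPullback φ G s G' s') (hy : y ∈ s) : ContDiffAt ℝ ∞ φ y :=
  h.smooth.contDiffAt (h.source.isOpen.mem_nhds hy)

theorem contDiffAt_fderiv (h : IsPullback φ G s G' s') (hy : y ∈ s) :
    ContDiffAt ℝ ∞ (fderiv ℝ φ) y :=
  (h.contDiffAt hy).fderiv_right (by simp)

theorem hasFDerivAt (h : IsPullback φ G s G' s') (hy : y ∈ s) : HasFDerivAt φ (fderiv ℝ φ y) y :=
  ((h.contDiffAt hy).differentiableAt (by simp)).hasFDerivAt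

theorem hasFDerivAt_fderiv (h : IsPullback φ G s G' s') (hy : y ∈ s) :
    HasFDerivAt (fderiv ℝ φ) (fderiv ℝ (fderiv ℝ φ) y) y :=
  ((h.contDiffAt_fderiv hy).differentiableAt (by simp)).hasFDerivAt

theorem hasFDerivAt_fderiv_fderiv (h : IsPullback φ G s G' s') (hy : y ∈ s) :
    HasFDerivAt (fderiv ℝ (fderiv ℝ φ)) (fderiv ℝ (fderiv ℝ (fderiv ℝ φ)) y) y :=
  (((h.contDiffAt_fderiv hy).fderiv_right (m := ∞) (by simp)).differentiableAt
    (by simp)).hasFDerivAt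

theorem second_fderiv_symm (h : IsPullback φ G s G' s') (hy : y ∈ s) (u v : E n) :
    fderiv ℝ (fderiv ℝ φ) y u v = fderiv ℝ (fderiv ℝ φ) y v u :=
  ((h.contDiffAt hy).isSymmSndFDerivAt (by simpa using two_le_infty)).eq u v

theorem third_fderiv_symm (h : IsPullback φ G s G' s') (hy : y ∈ s) (u v w : E n) :
    fderiv ℝ (fderiv ℝ (fderiv ℝ φ)) y u v w = fderiv ℝ (fderiv ℝ (fderiv ℝ φ)) y v u w := by
  rw [((h.contDiffAt_fderiv hy).isSymmSndFDerivAt (by simpa using two_le_infty)).eq u v]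

/-- The differential of a local isometry, as a linear equivalence. -/
def fderivEquiv (h : IsPullback φ G s G' s') (hy : y ∈ s) : E n ≃L[ℝ] E n :=
  (LinearEquiv.ofInjectiveEndo (fderiv ℝ φ y : E n →ₗ[ℝ] E n)
    ((h.source.isScalarProduct y hy).injective_of_isometry
      fun u v => (h.eq y hy u v).symm)).toContinuousLinearEquiv

theorem ext (h : IsPullback φ G s G' s') (hy : y ∈ s) {a b : E n}
    (hab : ∀ w, G' (φ y) a (fderiv ℝ φ y w) = G' (φ y) b (fderiv ℝ φ y w)) : a = b :=
  (h.target.isScalarProduct _ (h.mapsTo hy)).ext ((h.fderivEquiv hy).surjective.forall.2 hab)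

theorem fderiv_metric (h : IsPullback φ G s G' s') (hy : y ∈ s) (u v w : E n) :
    fderiv ℝ G y u v w =
      fderiv ℝ G' (φ y) (fderiv ℝ φ y u) (fderiv ℝ φ y v) (fderiv ℝ φ y w)
      + G' (φ y) (fderiv ℝ (fderiv ℝ φ) y u v) (fderiv ℝ φ y w)
      + G' (φ y) (fderiv ℝ φ y v) (fderiv ℝ (fderiv ℝ φ) y u w) := by
  have heq : (fun z => G z v w) =ᶠ[𝓝 y]
      fun z => G' (φ z) (fderiv ℝ φ z v) (fderiv ℝ φ z w) := by
    filter_upwards [h.source.isOpen.mem_nhds hy] with z hz using h.eq z hz v w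
  have hG' : HasFDerivAt (fun z => G' (φ z)) _ y :=
    (h.target.differentiableAt (h.mapsTo hy)).hasFDerivAt.comp y (h.hasFDerivAt hy)
  have hφ (a : E n) := (h.hasFDerivAt_fderiv hy).clm_apply (hasFDerivAt_const a y)
  rw [← fderiv_clm_apply₂ (h.source.differentiableAt hy), heq.fderiv_eq,
    ((hG'.clm_apply (hφ v)).clm_apply (hφ w)).fderiv]
  simp
  ring

theorem fderiv_apply_christoffel (h : IsPullback φ G s G' s') (hy : y ∈ s) (u v : E n) :
    fderiv ℝ φ y (christoffel G y u v) =
      fderiv ℝ (fderiv ℝ φ) y u v + christoffel G' (φ y) (fderiv ℝ φ y u) (fderiv ℝ φ y v) := by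
  refine h.ext hy fun w => ?_
  have hsymm := (h.target.isScalarProduct _ (h.mapsTo hy)).symm
  have hG := h.source.two_mul_apply_christoffel hy u v w
  have hG' := h.target.two_mul_apply_christoffel (h.mapsTo hy) (fderiv ℝ φ y u) (fderiv ℝ φ y v)
    (fderiv ℝ φ y w)
  rw [h.fderiv_metric hy, h.fderiv_metric hy, h.fderiv_metric hy, h.second_fderiv_symm hy v u,
    h.second_fderiv_symm hy w u, h.second_fderiv_symm hy w v,
    hsymm (fderiv ℝ φ y v) (fderiv ℝ (fderiv ℝ φ) y u w), h.eq y hy] at hG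
  rw [map_add, add_apply]
  linarith [hsymm (fderiv ℝ φ y u) (fderiv ℝ (fderiv ℝ φ) y v w)]

theorem fderiv_christoffelBil (h : IsPullback φ G s G' s') (hy : y ∈ s) (u v w : E n) :
    fderiv ℝ (fderiv ℝ φ) y u (christoffelBil G y v w)
      + fderiv ℝ φ y (fderiv ℝ (christoffelBil G) y u v w) =
    fderiv ℝ (fderiv ℝ (fderiv ℝ φ)) y u v w
      + fderiv ℝ (christoffelBil G') (φ y) (fderiv ℝ φ y u) (fderiv ℝ φ y v) (fderiv ℝ φ y w)
      + christoffelBil G' (φ y) (fderiv ℝ (fderiv ℝ φ) y u v) (fderiv ℝ φ y w)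
      + christoffelBil G' (φ y) (fderiv ℝ φ y v) (fderiv ℝ (fderiv ℝ φ) y u w) := by
  have heq : (fun z => fderiv ℝ φ z (christoffelBil G z v w)) =ᶠ[𝓝 y]
      fun z => fderiv ℝ (fderiv ℝ φ) z v w
        + christoffelBil G' (φ z) (fderiv ℝ φ z v) (fderiv ℝ φ z w) := by
    filter_upwards [h.source.isOpen.mem_nhds hy] with z hz using h.fderiv_apply_christoffel hz v w
  have hΓ := ((h.source.differentiableAt_christoffelBil hy).hasFDerivAt.clm_apply
    (hasFDerivAt_const v y)).clm_apply (hasFDerivAt_const w y)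
  have hΓ' := (h.target.differentiableAt_christoffelBil (h.mapsTo hy)).hasFDerivAt.comp y
    (h.hasFDerivAt hy)
  have hφ (a : E n) := (h.hasFDerivAt_fderiv hy).clm_apply (hasFDerivAt_const a y)
  have hφ' := ((h.hasFDerivAt_fderiv_fderiv hy).clm_apply (hasFDerivAt_const v y)).clm_apply
    (hasFDerivAt_const w y)
  have hderiv := DFunLike.congr_fun (((h.hasFDerivAt_fderiv hy).clm_apply hΓ).unique
    ((hφ'.add ((hΓ'.clm_apply (hφ v)).clm_apply (hφ w))).congr_of_eventuallyEq heq)) u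
  simp only [ContinuousLinearMap.comp_zero, add_apply, ContinuousLinearMap.comp_apply,
    ContinuousLinearMap.flip_apply, zero_add, Function.comp_apply] at hderiv
  rw [add_comm]
  refine hderiv.trans ?_
  abel

theorem fderiv_apply_curvatureForm (h : IsPullback φ G s G' s') (hy : y ∈ s) (u v w : E n) :
    fderiv ℝ φ y (curvatureForm G y u v w) =
      curvatureForm G' (φ y) (fderiv ℝ φ y u) (fderiv ℝ φ y v) (fderiv ℝ φ y w) := by
  have hΓ (a b : E n) : fderiv ℝ φ y (christoffelBil G y a b) = fderiv ℝ (fderiv ℝ φ) y a b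
      + christoffelBil G' (φ y) (fderiv ℝ φ y a) (fderiv ℝ φ y b) :=
    h.fderiv_apply_christoffel hy a b
  have huv := eq_sub_of_add_eq' (h.fderiv_christoffelBil hy u v w)
  have hvu := eq_sub_of_add_eq' (h.fderiv_christoffelBil hy v u w)
  rw [h.third_fderiv_symm hy v u, h.second_fderiv_symm hy v u] at hvu
  simp only [curvatureForm_apply, map_add, map_sub, huv, hvu, hΓ]
  abel

end IsPullback

/-- The map of tractors given by a linear map of the tangent component. -/
def tractorMap (L : E n →L[ℝ] E n) : Tractor n →L[ℝ] Tractor n :=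
  (ContinuousLinearMap.id ℝ ℝ).prodMap (L.prodMap (ContinuousLinearMap.id ℝ ℝ))

theorem tractorMap_apply (L : E n →L[ℝ] E n) (τ : Tractor n) :
    tractorMap L τ = (τ.1, L τ.2.1, τ.2.2) := rfl

theorem trace_eq_sum_ebasis (A : E n →L[ℝ] E n) :
    LinearMap.trace ℝ (E n) A = ∑ i, A (ebasis i) i := by
  rw [LinearMap.trace_eq_matrix_trace ℝ (EuclideanSpace.basisFun (Fin n) ℝ).toBasis]
  simp [Matrix.trace, LinearMap.toMatrix_apply, ebasis]

theorem trace_eq_of_conj {A A' : E n →L[ℝ] E n} (L : E n ≃L[ℝ] E n)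
    (hL : ∀ u, L (A u) = A' (L u)) :
    LinearMap.trace ℝ (E n) A = LinearMap.trace ℝ (E n) A' := by
  rw [← LinearMap.trace_conj' (A : E n →ₗ[ℝ] E n) L.toLinearEquiv]
  congr 1
  ext1 u
  simp [LinearEquiv.conj_apply, hL]

theorem ricciBil_eq_trace (v w : E n) :
    ricciBil G y v w = LinearMap.trace ℝ (E n) (((curvatureForm G y).flip v).flip w) := by
  simp [trace_eq_sum_ebasis, ricciBil, sum_apply]

theorem IsMetricOn.scalarCurv_eq_trace (h : IsMetricOn G s) (hy : y ∈ s) :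
    scalarCurv G y = LinearMap.trace ℝ (E n) ((G y).inverse ∘L (ricciBil G y).flip) := by
  rw [trace_eq_sum_ebasis, scalarCurv]
  refine Finset.sum_congr rfl fun i _ => ?_
  have hproj := DFunLike.congr_fun (h.apply_sharp hy (EuclideanSpace.proj i))
    ((G y).inverse ((ricciBil G y).flip (ebasis i)))
  rw [(h.isScalarProduct y hy).symm] at hproj
  refine (h.ricci_eq hy _ _).trans (Eq.trans ?_ hproj)
  exact (DFunLike.congr_fun (h.apply_sharp hy ((ricciBil G y).flip (ebasis i))) _).symm

namespace IsPullback

theorem fderiv_apply_sharp (h : IsPullback φ G s G' s') (hy : y ∈ s) {θ θ' : E n →L[ℝ] ℝ}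
    (hθ : ∀ w, θ w = θ' (fderiv ℝ φ y w)) :
    fderiv ℝ φ y (sharp G y θ) = sharp G' (φ y) θ' :=
  h.ext hy fun w => by
    rw [← h.eq y hy, h.source.apply_sharp hy, h.target.apply_sharp (h.mapsTo hy), hθ]

theorem ricciBil_eq (h : IsPullback φ G s G' s') (hy : y ∈ s) (v w : E n) :
    ricciBil G y v w = ricciBil G' (φ y) (fderiv ℝ φ y v) (fderiv ℝ φ y w) := by
  rw [ricciBil_eq_trace, ricciBil_eq_trace]
  exact trace_eq_of_conj (h.fderivEquiv hy) fun u => h.fderiv_apply_curvatureForm hy u v w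

theorem scalarCurv_eq (h : IsPullback φ G s G' s') (hy : y ∈ s) :
    scalarCurv G y = scalarCurv G' (φ y) := by
  rw [h.source.scalarCurv_eq_trace hy, h.target.scalarCurv_eq_trace (h.mapsTo hy)]
  exact trace_eq_of_conj (h.fderivEquiv hy) fun u =>
    h.fderiv_apply_sharp hy fun w => h.ricciBil_eq hy w u

theorem schoutenBil_eq (h : IsPullback φ G s G' s') (hy : y ∈ s) (v w : E n) :
    schoutenBil G y v w = schoutenBil G' (φ y) (fderiv ℝ φ y v) (fderiv ℝ φ y w) := by
  simp [schoutenBil, h.ricciBil_eq hy, h.scalarCurv_eq hy, h.eq y hy]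

theorem tractorMap_tractorForm (h : IsPullback φ G s G' s') (hy : y ∈ s) (X : E n)
    (τ : Tractor n) :
    tractorMap (fderiv ℝ φ y) (tractorForm G y X τ) =
      tractorForm G' (φ y) (fderiv ℝ φ y X) (tractorMap (fderiv ℝ φ y) τ) +
        (0, fderiv ℝ (fderiv ℝ φ) y X τ.2.1, 0) := by
  have hP := h.fderiv_apply_sharp hy (h.schoutenBil_eq hy X)
  simp only [tractorMap_apply, tractorForm_apply, map_add, map_smul, christoffelBil_apply,
    h.fderiv_apply_christoffel hy, hP, ← h.schoutenBil_eq hy, ← h.eq y hy, Prod.mk_add_mk,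
    add_zero]
  congr 2
  abel

end IsPullback

end Pullback

section CoordinateFields

variable {n : ℕ} {G : E n → Bil n} {s : Set (E n)} {c : ℝ → E n} {c' : E n}
  {τ τ' : ℝ → Tractor n} {t : ℝ}

theorem hasDerivAt_tractor_iff {τ₁ : Tractor n} :
    HasDerivAt τ τ₁ t ↔ HasDerivAt (fun r => (τ r).1) τ₁.1 t ∧
      HasDerivAt (fun r => (τ r).2.1) τ₁.2.1 t ∧ HasDerivAt (fun r => (τ r).2.2) τ₁.2.2 t := by
  refine ⟨fun h => ⟨?_, ?_, ?_⟩, fun h => h.1.prodMk (h.2.1.prodMk h.2.2)⟩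
  · simpa using h.hasFDerivAt.fst.hasDerivAt
  · simpa using h.hasFDerivAt.snd.fst.hasDerivAt
  · simpa using h.hasFDerivAt.snd.snd.hasDerivAt

theorem hasDerivAt_tractorMap {L : ℝ → E n →L[ℝ] E n} {L' : E n →L[ℝ] E n} {τ₁ : Tractor n}
    (hL : HasDerivAt L L' t) (hτ : HasDerivAt τ τ₁ t) :
    HasDerivAt (fun r => tractorMap (L r) (τ r))
      (tractorMap (L t) τ₁ + (0, L' (τ t).2.1, 0)) t := by
  obtain ⟨htop, hmid, hbot⟩ := hasDerivAt_tractor_iff.1 hτ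
  refine (htop.prodMk ((hL.clm_apply hmid).prodMk hbot)).congr_deriv ?_
  simp [tractorMap_apply, add_comm]

theorem hasDerivAt_tractorBil_of_parallel (h : IsMetricOn G s) (hs : c t ∈ s)
    (hc : HasDerivAt c c' t) (hτ : HasDerivAt τ (-tractorForm G (c t) c' (τ t)) t)
    (hτ' : HasDerivAt τ' (-tractorForm G (c t) c' (τ' t)) t) :
    HasDerivAt (fun r => tractorBil (G (c r)) (τ r) (τ' r)) 0 t := by
  have hG := (h.differentiableAt hs).hasFDerivAt.comp_hasDerivAt t hc
  obtain ⟨htop, hmid, hbot⟩ := hasDerivAt_tractor_iff.1 hτ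
  obtain ⟨htop', hmid', hbot'⟩ := hasDerivAt_tractor_iff.1 hτ'
  refine (((htop.mul hbot').add (htop'.mul hbot)).add
    ((hG.clm_apply hmid).clm_apply hmid')).congr_deriv ?_
  have hskew := h.tractorBil_tractorForm hs c' (τ t) (τ' t)
  simp only [tractorBil_apply] at hskew
  simp only [Prod.fst_neg, Prod.snd_neg, map_neg, add_apply, neg_apply, Function.comp_apply]
  linarith

end CoordinateFields

section Charts

variable {n : ℕ} {M : Type*} [TopologicalSpace M] [ChartedSpace (E n) M]

/-- The domain of the change from the chart centred at `x₀` to the chart centred at `x₁`. -/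
def overlap (n : ℕ) {M : Type*} [TopologicalSpace M] [ChartedSpace (E n) M] (x₀ x₁ : M) :
    Set (E n) :=
  (extChartAt (𝓡 n) x₀).target ∩ (extChartAt (𝓡 n) x₀).symm ⁻¹' (extChartAt (𝓡 n) x₁).source

/-- The change from the chart centred at `x₀` to the chart centred at `x₁`. -/
def transition (n : ℕ) {M : Type*} [TopologicalSpace M] [ChartedSpace (E n) M] (x₀ x₁ : M) :
    E n → E n :=
  extChartAt (𝓡 n) x₁ ∘ (extChartAt (𝓡 n) x₀).symm

theorem isOpen_overlap (x₀ x₁ : M) : IsOpen (overlap n x₀ x₁) :=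
  (continuousOn_extChartAt_symm x₀).isOpen_inter_preimage (isOpen_extChartAt_target x₀)
    (isOpen_extChartAt_source x₁)

theorem extChartAt_mem_overlap {x₀ x₁ x : M} (h₀ : x ∈ (extChartAt (𝓡 n) x₀).source)
    (h₁ : x ∈ (extChartAt (𝓡 n) x₁).source) : extChartAt (𝓡 n) x₀ x ∈ overlap n x₀ x₁ :=
  ⟨(extChartAt (𝓡 n) x₀).map_source h₀, by rwa [mem_preimage, (extChartAt (𝓡 n) x₀).left_inv h₀]⟩

theorem transition_extChartAt {x₀ x : M} (x₁ : M) (h₀ : x ∈ (extChartAt (𝓡 n) x₀).source) :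
    transition n x₀ x₁ (extChartAt (𝓡 n) x₀ x) = extChartAt (𝓡 n) x₁ x := by
  rw [transition, Function.comp_apply, (extChartAt (𝓡 n) x₀).left_inv h₀]

variable [IsManifold (𝓡 n) ∞ M]

theorem contDiffOn_transition (x₀ x₁ : M) :
    ContDiffOn ℝ ∞ (transition n x₀ x₁) (overlap n x₀ x₁) :=
  contDiffOn_ext_coord_change x₁ x₀

/-- The differential at `x` of the chart centred at `x₀`. -/
def chartD (x₀ x : M) : E n →L[ℝ] E n :=
  mfderiv (𝓡 n) 𝓘(ℝ, E n) (extChartAt (𝓡 n) x₀) x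

/-- The differential at `y` of the inverse of the chart centred at `x₀`. -/
def chartDInv (x₀ : M) (y : E n) : E n →L[ℝ] E n :=
  mfderiv 𝓘(ℝ, E n) (𝓡 n) (extChartAt (𝓡 n) x₀).symm y

theorem chartD_self (x : M) : chartD (n := n) x x = ContinuousLinearMap.id ℝ (E n) :=
  mfderiv_extChartAt_self

theorem chartD_chartDInv {x₀ : M} {y : E n} (hy : y ∈ (extChartAt (𝓡 n) x₀).target) (u : E n) :
    chartD x₀ ((extChartAt (𝓡 n) x₀).symm y) (chartDInv x₀ y u) = u := by
  have h := mfderiv_extChartAt_comp_mfderivWithin_extChartAt_symm (I := 𝓡 n) hy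
  rw [ModelWithCorners.range_eq_univ, mfderivWithin_univ] at h
  exact DFunLike.congr_fun h u

theorem chartDInv_chartD {x₀ x : M} (hx : x ∈ (extChartAt (𝓡 n) x₀).source) (u : E n) :
    chartDInv x₀ (extChartAt (𝓡 n) x₀ x) (chartD x₀ x u) = u := by
  have h := mfderivWithin_extChartAt_symm_comp_mfderiv_extChartAt' (I := 𝓡 n) hx
  rw [ModelWithCorners.range_eq_univ, mfderivWithin_univ] at h
  exact DFunLike.congr_fun h u

theorem trivializationAt_eq_chartD {x₀ x : M} (hx : x ∈ (extChartAt (𝓡 n) x₀).source)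
    (u : TangentSpace (𝓡 n) x) :
    (trivializationAt (E n) (TangentSpace (𝓡 n)) x₀ ⟨x, u⟩).2 = chartD x₀ x u := by
  rw [extChartAt_source] at hx
  rw [← Bundle.Trivialization.continuousLinearMapAt_apply_of_mem (R := ℝ)]
  · exact DFunLike.congr_fun (TangentBundle.continuousLinearMapAt_trivializationAt hx) u
  · simpa using hx

theorem fderiv_transition {x₀ x₁ : M} {y : E n} (hy : y ∈ overlap n x₀ x₁) (u : E n) :
    fderiv ℝ (transition n x₀ x₁) y u =
      chartD x₁ ((extChartAt (𝓡 n) x₀).symm y) (chartDInv x₀ y u) := by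
  have hsymm := mdifferentiableWithinAt_extChartAt_symm (I := 𝓡 n) hy.1
  rw [ModelWithCorners.range_eq_univ, mdifferentiableWithinAt_univ] at hsymm
  rw [← mfderiv_eq_fderiv, transition, mfderiv_comp (I' := 𝓡 n) _ _ hsymm]
  · rfl
  · apply mdifferentiableAt_extChartAt
    simpa using hy.2

theorem chartD_eq_fderiv_transition {x₀ x₁ x : M} (h₀ : x ∈ (extChartAt (𝓡 n) x₀).source)
    (h₁ : x ∈ (extChartAt (𝓡 n) x₁).source) (u : E n) :
    chartD x₁ x u = fderiv ℝ (transition n x₀ x₁) (extChartAt (𝓡 n) x₀ x) (chartD x₀ x u) := by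
  rw [fderiv_transition (extChartAt_mem_overlap h₀ h₁), chartDInv_chartD h₀,
    (extChartAt (𝓡 n) x₀).left_inv h₀]

theorem contMDiffOn_coordField (x₀ : M) (u : E n) :
    ContMDiffOn 𝓘(ℝ, E n) ((𝓡 n).prod 𝓘(ℝ, E n)) ∞
      (fun y => Bundle.TotalSpace.mk' (E n) (E := fun x : M => TangentSpace (𝓡 n) x)
        ((extChartAt (𝓡 n) x₀).symm y) (chartDInv x₀ y u)) (extChartAt (𝓡 n) x₀).target := by
  rw [(trivializationAt (E n) (TangentSpace (𝓡 n)) x₀).contMDiffOn_iff]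
  · refine ⟨contMDiffOn_extChartAt_symm x₀, (contMDiffOn_const (c := u)).congr fun y hy => ?_⟩
    exact (trivializationAt_eq_chartD ((extChartAt (𝓡 n) x₀).map_target hy) _).trans
      (chartD_chartDInv hy u)
  · intro y hy
    have := (extChartAt (𝓡 n) x₀).map_target hy
    rw [extChartAt_source] at this
    simpa using this

end Charts

section CoordMetric

variable {n p q : ℕ} {M : Type*} [TopologicalSpace M] [ChartedSpace (E n) M]
  [IsManifold (𝓡 n) ∞ M]

/-- The scalar product of `g` on `T_x M`, as a bilinear form on the model space, with which
`T_x M` is identified by the chart centred at `x`. -/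
def metricAt (g : Metric n p q M) (x : M) : Bil n := g.val x

theorem isScalarProduct_metricAt (g : Metric n p q M) (x : M) : IsScalarProduct (metricAt g x) where
  symm := g.symm x
  eq_zero (u : TangentSpace (𝓡 n) x) hu := by
    obtain ⟨b, hb⟩ := g.signature x
    refine b.forall_coord_eq_zero_iff.1 fun i => ?_
    have h : g.val x u (b i) = 0 := hu (b i)
    rw [← b.sum_repr u, map_sum, sum_apply] at h
    simp only [map_smul, smul_apply, hb, smul_eq_mul] at h
    rw [Finset.sum_eq_single i (by intro j _ hj; simp [hj]) (by simp)] at h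
    rcases i with i | i <;> simpa using h

theorem tractorMetric_eq (g : Metric n p q M) (x : M) (τ τ' : Tractor n) :
    tractorMetric g x τ τ' = tractorBil (metricAt g x) τ τ' := rfl

theorem coordMetric_apply (g : Metric n p q M) (x₀ : M) (y u v : E n) :
    coordMetric g x₀ y u v = metricAt g ((extChartAt (𝓡 n) x₀).symm y)
      (chartDInv x₀ y u) (chartDInv x₀ y v) := rfl

theorem coordMetric_chartD (g : Metric n p q M) {x₀ x : M}
    (hx : x ∈ (extChartAt (𝓡 n) x₀).source) (u v : E n) :
    coordMetric g x₀ (extChartAt (𝓡 n) x₀ x) (chartD x₀ x u) (chartD x₀ x v) =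
      metricAt g x u v := by
  rw [coordMetric_apply, chartDInv_chartD hx, chartDInv_chartD hx,
    (extChartAt (𝓡 n) x₀).left_inv hx]

theorem contDiffOn_coordMetric (g : Metric n p q M) (x₀ : M) :
    ContDiffOn ℝ ∞ (coordMetric g x₀) (extChartAt (𝓡 n) x₀).target := by
  refine contDiffOn_clm_apply.2 fun u => contDiffOn_clm_apply.2 fun v => ?_
  have h : ContMDiffOn 𝓘(ℝ, E n) ((𝓡 n).prod 𝓘(ℝ, ℝ)) ∞
      (fun y => Bundle.TotalSpace.mk' ℝ (E := Bundle.Trivial M ℝ) ((extChartAt (𝓡 n) x₀).symm y)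
        (g.val ((extChartAt (𝓡 n) x₀).symm y) (chartDInv x₀ y u) (chartDInv x₀ y v)))
      (extChartAt (𝓡 n) x₀).target :=
    ContMDiffOn.clm_bundle_apply₂ (F₁ := E n) (F₂ := E n)
      (g.smooth.comp_contMDiffOn (contMDiffOn_extChartAt_symm x₀))
      (contMDiffOn_coordField x₀ u) (contMDiffOn_coordField x₀ v)
  exact contMDiffOn_iff_contDiffOn.1 fun y hy =>
    (Bundle.contMDiffWithinAt_totalSpace.1 (h y hy)).2

theorem isScalarProduct_coordMetric (g : Metric n p q M) {x₀ : M} {y : E n}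
    (hy : y ∈ (extChartAt (𝓡 n) x₀).target) : IsScalarProduct (coordMetric g x₀ y) where
  symm u v := g.symm _ _ _
  eq_zero u hu := by
    have hinv (v : E n) : chartDInv x₀ y (chartD x₀ ((extChartAt (𝓡 n) x₀).symm y) v) = v := by
      simpa only [(extChartAt (𝓡 n) x₀).right_inv hy] using
        chartDInv_chartD ((extChartAt (𝓡 n) x₀).map_target hy) v
    have hu' : chartDInv x₀ y u = 0 := (isScalarProduct_metricAt g _).eq_zero _ fun v => by
      rw [← hinv v, ← coordMetric_apply, hu]
    rw [← chartD_chartDInv hy u, hu', map_zero]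

theorem isMetricOn_coordMetric (g : Metric n p q M) (x₀ : M) :
    IsMetricOn (coordMetric g x₀) (extChartAt (𝓡 n) x₀).target where
  isOpen := isOpen_extChartAt_target x₀
  smooth := contDiffOn_coordMetric g x₀
  isScalarProduct _ hy := isScalarProduct_coordMetric g hy

theorem isPullback_transition (g : Metric n p q M) (x₀ x₁ : M) :
    IsPullback (transition n x₀ x₁) (coordMetric g x₀) (overlap n x₀ x₁) (coordMetric g x₁)
      (extChartAt (𝓡 n) x₁).target where
  source :=
    { isOpen := isOpen_overlap x₀ x₁
      smooth := (contDiffOn_coordMetric g x₀).mono inter_subset_left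
      isScalarProduct := fun _ hy => isScalarProduct_coordMetric g hy.1 }
  target := isMetricOn_coordMetric g x₁
  smooth := contDiffOn_transition x₀ x₁
  mapsTo y hy := (extChartAt (𝓡 n) x₁).map_source hy.2
  eq y hy u v := by
    rw [fderiv_transition hy, fderiv_transition hy, transition, Function.comp_apply,
      coordMetric_chartD g hy.2, coordMetric_apply]

end CoordMetric

section ParallelFields

variable {n p q : ℕ} {M : Type*} [TopologicalSpace M] [ChartedSpace (E n) M]
  [IsManifold (𝓡 n) ∞ M] {g : Metric n p q M} {γ γ' : ℝ → M} {τ τ' : ℝ → Tractor n} {t : ℝ}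
  {x₀ : M}

theorem tractorMap_chartD_self (x : M) (τ : Tractor n) : tractorMap (chartD x x) τ = τ := by
  rw [chartD_self]
  rfl

theorem tractorMap_chartD_chartDInv {y : E n} (hy : y ∈ (extChartAt (𝓡 n) x₀).target)
    (τ : Tractor n) :
    tractorMap (chartD x₀ ((extChartAt (𝓡 n) x₀).symm y)) (tractorMap (chartDInv x₀ y) τ) = τ := by
  simp only [tractorMap_apply, chartD_chartDInv hy]

theorem tractorMap_chartDInv_chartD {x : M} (hx : x ∈ (extChartAt (𝓡 n) x₀).source)
    (τ : Tractor n) :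
    tractorMap (chartDInv x₀ (extChartAt (𝓡 n) x₀ x)) (tractorMap (chartD x₀ x) τ) = τ := by
  simp only [tractorMap_apply, chartDInv_chartD hx]

theorem tractorMetric_eq_chart (g : Metric n p q M) {x : M}
    (hx : x ∈ (extChartAt (𝓡 n) x₀).source) (τ τ' : Tractor n) :
    tractorMetric g x τ τ' = tractorBil (coordMetric g x₀ (extChartAt (𝓡 n) x₀ x))
      (tractorMap (chartD x₀ x) τ) (tractorMap (chartD x₀ x) τ') := by
  rw [tractorMetric_eq, tractorBil_apply, tractorBil_apply]
  simp only [tractorMap_apply, coordMetric_chartD g hx]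

theorem isParallelAt_iff :
    IsParallelAt g γ τ t ↔ HasDerivAt (fun s => tractorMap (chartD (γ t) (γ s)) (τ s))
      (-tractorForm (coordMetric g (γ t)) (extChartAt (𝓡 n) (γ t) (γ t))
        (deriv (fun s => extChartAt (𝓡 n) (γ t) (γ s)) t) (τ t)) t := by
  have hG := isMetricOn_coordMetric g (γ t)
  have hy := mem_extChartAt_target (I := 𝓡 n) (γ t)
  have hmid (c' : E n) : -(christoffel (coordMetric g (γ t)) (extChartAt (𝓡 n) (γ t) (γ t)) c'
        (τ t).2.1) - (τ t).1 • c'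
        - (τ t).2.2 • schoutenEnd (coordMetric g (γ t)) (extChartAt (𝓡 n) (γ t) (γ t)) c' =
      (-tractorForm (coordMetric g (γ t)) (extChartAt (𝓡 n) (γ t) (γ t)) c' (τ t)).2.1 := by
    simp only [tractorForm_apply, Prod.snd_neg, Prod.fst_neg, hG.schoutenEnd_eq hy,
      christoffelBil_apply]
    abel
  rw [hasDerivAt_tractor_iff, ← hmid]
  simp only [tractorForm_apply, Prod.snd_neg, Prod.fst_neg, neg_neg, ← hG.schouten_eq hy]
  exact ⟨fun h => ⟨h.top, h.mid, h.bot⟩, fun h => ⟨h.1, h.2.1, h.2.2⟩⟩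

theorem isParallelAt_of_chart {c' : E n} (hx : γ t ∈ (extChartAt (𝓡 n) x₀).source)
    (hγ : ContinuousAt γ t) (hc : HasDerivAt (fun s => extChartAt (𝓡 n) x₀ (γ s)) c' t)
    (hτ : HasDerivAt (fun s => tractorMap (chartD x₀ (γ s)) (τ s))
      (-tractorForm (coordMetric g x₀) (extChartAt (𝓡 n) x₀ (γ t)) c'
        (tractorMap (chartD x₀ (γ t)) (τ t))) t) :
    IsParallelAt g γ τ t := by
  have hφ := isPullback_transition g x₀ (γ t)
  have hx' := mem_extChartAt_source (I := 𝓡 n) (γ t)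
  have hy := extChartAt_mem_overlap hx hx'
  have hnear : ∀ᶠ s in 𝓝 t, γ s ∈ (extChartAt (𝓡 n) x₀).source ∧
      γ s ∈ (extChartAt (𝓡 n) (γ t)).source :=
    (hγ.eventually ((isOpen_extChartAt_source x₀).mem_nhds hx)).and
      (hγ.eventually ((isOpen_extChartAt_source (γ t)).mem_nhds hx'))
  have hc₁ : HasDerivAt (fun s => extChartAt (𝓡 n) (γ t) (γ s))
      (fderiv ℝ (transition n x₀ (γ t)) (extChartAt (𝓡 n) x₀ (γ t)) c') t := by
    refine ((hφ.hasFDerivAt hy).comp_hasDerivAt t hc).congr_of_eventuallyEq ?_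
    filter_upwards [hnear] with s hs using (transition_extChartAt _ hs.1).symm
  have hD {s : ℝ} (hs : γ s ∈ (extChartAt (𝓡 n) x₀).source ∧
      γ s ∈ (extChartAt (𝓡 n) (γ t)).source) (σ : Tractor n) :
      tractorMap (chartD (γ t) (γ s)) σ =
        tractorMap (fderiv ℝ (transition n x₀ (γ t)) (extChartAt (𝓡 n) x₀ (γ s)))
          (tractorMap (chartD x₀ (γ s)) σ) := by
    simp only [tractorMap_apply, chartD_eq_fderiv_transition hs.1 hs.2]
  rw [isParallelAt_iff, hc₁.deriv]
  refine ((hasDerivAt_tractorMap ((hφ.hasFDerivAt_fderiv hy).comp_hasDerivAt t hc)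
    hτ).congr_of_eventuallyEq (hnear.mono fun s hs => hD hs (τ s))).congr_deriv ?_
  rw [Function.comp_apply, map_neg, hφ.tractorMap_tractorForm hy, transition_extChartAt _ hx,
    ← hD ⟨hx, hx'⟩, tractorMap_chartD_self, neg_add, neg_add_cancel_right]

theorem hasDerivAt_tractorMetric (hγ : ContinuousAt γ t)
    (hc : DifferentiableAt ℝ (fun s => extChartAt (𝓡 n) (γ t) (γ s)) t)
    (h : IsParallelAt g γ τ t) (h' : IsParallelAt g γ τ' t) :
    HasDerivAt (fun s => tractorMetric g (γ s) (τ s) (τ' s)) 0 t := by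
  rw [isParallelAt_iff, ← tractorMap_chartD_self (γ t) (τ t)] at h
  rw [isParallelAt_iff, ← tractorMap_chartD_self (γ t) (τ' t)] at h'
  refine (hasDerivAt_tractorBil_of_parallel (isMetricOn_coordMetric g (γ t))
    (mem_extChartAt_target _) hc.hasDerivAt h h').congr_of_eventuallyEq ?_
  filter_upwards [hγ.eventually ((isOpen_extChartAt_source (γ t)).mem_nhds
    (mem_extChartAt_source (I := 𝓡 n) (γ t)))] with s hs using tractorMetric_eq_chart g hs _ _

theorem IsParallelAt.congr (h : IsParallelAt g γ τ t) (hγ : γ' =ᶠ[𝓝 t] γ)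
    (hτ : τ' =ᶠ[𝓝 t] τ) : IsParallelAt g γ' τ' t := by
  rw [isParallelAt_iff] at h ⊢
  have hc : (fun s => extChartAt (𝓡 n) (γ t) (γ' s)) =ᶠ[𝓝 t]
      fun s => extChartAt (𝓡 n) (γ t) (γ s) := hγ.fun_comp _
  rw [hγ.eq_of_nhds, hτ.eq_of_nhds, hc.deriv_eq]
  refine h.congr_of_eventuallyEq ?_
  filter_upwards [hγ, hτ] with s hs hs'
  rw [hs, hs']

theorem IsParallelAt.comp_affine {a b : ℝ} (h : IsParallelAt g γ τ (a * t + b)) :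
    IsParallelAt g (fun s => γ (a * s + b)) (fun s => τ (a * s + b)) t := by
  rw [isParallelAt_iff] at h ⊢
  have hd : deriv (fun s => extChartAt (𝓡 n) (γ (a * t + b)) (γ (a * s + b))) t =
      a • deriv (fun s => extChartAt (𝓡 n) (γ (a * t + b)) (γ s)) (a * t + b) := by
    rw [deriv_comp_mul_left a (fun s => extChartAt (𝓡 n) (γ (a * t + b)) (γ (s + b))) t,
      deriv_comp_add_const (fun s => extChartAt (𝓡 n) (γ (a * t + b)) (γ s)) b]
  have ha : HasDerivAt (fun s : ℝ => a * s + b) a t := by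
    simpa using ((hasDerivAt_id t).const_mul a).add_const b
  refine (h.scomp t ha).congr_deriv ?_
  rw [hd, map_smul, smul_apply, smul_neg]

/-- The curve in `ℝ × TM × ℝ` of a field of tractors `τ` along `γ`. -/
def tractorCurve (γ : ℝ → M) (τ : ℝ → Tractor n) (t : ℝ) : ℝ × TangentBundle (𝓡 n) M × ℝ :=
  ((τ t).1, ⟨γ t, (τ t).2.1⟩, (τ t).2.2)

theorem isParallelAlong_iff : IsParallelAlong g γ τ ↔ ContinuousOn (tractorCurve γ τ) (Icc 0 1) ∧
    ∃ F : Finset ℝ, ∀ t ∈ Ioo (0 : ℝ) 1, t ∉ F → IsParallelAt g γ τ t :=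
  ⟨fun ⟨htop, hmid, hbot, hF⟩ => ⟨htop.prodMk (hmid.prodMk hbot), hF⟩,
    fun ⟨hc, hF⟩ => ⟨hc.fst, hc.snd.fst, hc.snd.snd, hF⟩⟩

theorem continuousWithinAt_tangentBundle_iff {v : ∀ r, TangentSpace (𝓡 n) (γ r)} {s : Set ℝ}
    (hx : γ t ∈ (extChartAt (𝓡 n) x₀).source) :
    ContinuousWithinAt (fun r => (⟨γ r, v r⟩ : TangentBundle (𝓡 n) M)) s t ↔
      ContinuousWithinAt γ s t ∧ ContinuousWithinAt (fun r => chartD x₀ (γ r) (v r)) s t := by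
  rw [ContinuousWithinAt, (trivializationAt (E n) (TangentSpace (𝓡 n)) x₀).tendsto_nhds_iff
    (by simpa using hx)]
  refine and_congr_right fun hγ => ?_
  rw [trivializationAt_eq_chartD hx]
  refine Filter.tendsto_congr' ?_
  filter_upwards [Filter.Tendsto.eventually hγ ((isOpen_extChartAt_source x₀).mem_nhds hx)]
    with r hr using trivializationAt_eq_chartD hr _

theorem continuousWithinAt_tractorCurve_iff {s : Set ℝ}
    (hx : γ t ∈ (extChartAt (𝓡 n) x₀).source) :
    ContinuousWithinAt (tractorCurve γ τ) s t ↔ ContinuousWithinAt γ s t ∧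
      ContinuousWithinAt (fun r => tractorMap (chartD x₀ (γ r)) (τ r)) s t := by
  have hmid := continuousWithinAt_tangentBundle_iff (s := s) (v := fun r => (τ r).2.1) hx
  refine ⟨fun h => ?_, fun ⟨hγ, h⟩ => h.fst.prodMk ((hmid.2 ⟨hγ, h.snd.fst⟩).prodMk h.snd.snd)⟩
  have hv := hmid.1 h.snd.fst
  exact ⟨hv.1, h.fst.prodMk (hv.2.prodMk h.snd.snd)⟩

theorem continuousOn_tractorMetric {s : Set ℝ} (h : ContinuousOn (tractorCurve γ τ) s)
    (h' : ContinuousOn (tractorCurve γ τ') s) :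
    ContinuousOn (fun t => tractorMetric g (γ t) (τ t) (τ' t)) s := fun t ht => by
  have hx := mem_extChartAt_source (I := 𝓡 n) (γ t)
  obtain ⟨hγ, hτ⟩ := (continuousWithinAt_tractorCurve_iff hx).1 (h t ht)
  obtain ⟨-, hτ'⟩ := (continuousWithinAt_tractorCurve_iff hx).1 (h' t ht)
  have hG : ContinuousWithinAt (fun r => coordMetric g (γ t) (extChartAt (𝓡 n) (γ t) (γ r))) s t :=
    ((contDiffOn_coordMetric g (γ t)).contDiffAt
      (extChartAt_target_mem_nhds (γ t))).continuousAt.comp_continuousWithinAt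
      (f := fun r => extChartAt (𝓡 n) (γ t) (γ r))
      ((continuousAt_extChartAt (γ t)).comp_continuousWithinAt hγ)
  refine (((hτ.fst.mul hτ'.snd.snd).add (hτ'.fst.mul hτ.snd.snd)).add
    ((hG.clm_apply hτ.snd.fst).clm_apply hτ'.snd.fst)).congr_of_eventuallyEq ?_
    (tractorMetric_eq_chart g hx _ _)
  filter_upwards [hγ.eventually ((isOpen_extChartAt_source (γ t)).mem_nhds hx)] with r hr
    using tractorMetric_eq_chart g hr _ _

end ParallelFields

section Concatenation

variable {X : Type*} {f₁ f₂ : ℝ → X}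

/-- The concatenation of two curves on `[0, 1]`, parametrized like `Path.trans`. -/
def concat (f₁ f₂ : ℝ → X) (t : ℝ) : X := if t ≤ 1 / 2 then f₁ (2 * t) else f₂ (2 * t - 1)

theorem concat_of_le_half {t : ℝ} (ht : t ≤ 1 / 2) : concat f₁ f₂ t = f₁ (2 * t) := if_pos ht

theorem concat_of_half_le (h : f₁ 1 = f₂ 0) {t : ℝ} (ht : 1 / 2 ≤ t) :
    concat f₁ f₂ t = f₂ (2 * t - 1) := by
  rcases ht.eq_or_lt with rfl | ht
  · norm_num [concat, h]
  · exact if_neg (not_le.2 ht)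

theorem concat_zero : concat f₁ f₂ 0 = f₁ 0 := by simp [concat]

theorem concat_one : concat f₁ f₂ 1 = f₂ 1 := by norm_num [concat]

variable [TopologicalSpace X]

theorem extend_trans_eq_concat {x y z : X} (γ : Path x y) (γ' : Path y z) :
    (γ.trans γ').extend = concat γ.extend γ'.extend := by
  funext t
  rcases le_total t (1 / 2) with ht | ht
  · rw [Path.extend_trans_of_le_half _ _ ht, concat_of_le_half ht]
  · rw [Path.extend_trans_of_half_le _ _ ht, concat_of_half_le (by simp) ht]

theorem continuousOn_concat (h₁ : ContinuousOn f₁ (Icc 0 1)) (h₂ : ContinuousOn f₂ (Icc 0 1))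
    (h : f₁ 1 = f₂ 0) : ContinuousOn (concat f₁ f₂) (Icc 0 1) := by
  rw [← Icc_union_Icc_eq_Icc (b := (1 / 2 : ℝ)) (by norm_num) (by norm_num)]
  refine ContinuousOn.union_of_isClosed ?_ ?_ isClosed_Icc isClosed_Icc
  · refine (h₁.comp (f := fun t => 2 * t) (by fun_prop) fun t ht => ?_).congr
      fun t ht => concat_of_le_half ht.2
    exact ⟨by linarith [ht.1], by linarith [ht.2]⟩
  · refine (h₂.comp (f := fun t => 2 * t - 1) (by fun_prop) fun t ht => ?_).congr
      fun t ht => concat_of_half_le h ht.1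
    exact ⟨by linarith [ht.1], by linarith [ht.2]⟩

end Concatenation

section Curves

variable {n : ℕ} {M : Type*} [TopologicalSpace M] [ChartedSpace (E n) M] {γ γ' : ℝ → M}

theorem IsPiecewiseSmooth.exists_finset (h : IsPiecewiseSmooth (n := n) γ) :
    ∃ F : Finset ℝ, ∀ t ∈ Ioo (0 : ℝ) 1, t ∉ F → ContMDiffAt 𝓘(ℝ, ℝ) (𝓡 n) ∞ γ t := by
  obtain ⟨F, hF⟩ := h
  refine ⟨F, fun t ht htF => ?_⟩
  obtain ⟨a, b, -, hnhds, hsub⟩ := exists_Icc_mem_subset_of_mem_nhds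
    ((F.finite_toSet.isClosed.isOpen_compl.inter isOpen_Ioo).mem_nhds ⟨htF, ht⟩)
  obtain ⟨hat, htb⟩ := Icc_mem_nhds_iff.1 hnhds
  have hab : a ≤ b := (hat.trans htb).le
  exact (hF a b (hsub (left_mem_Icc.2 hab)).2.1.le (hat.trans htb)
    (hsub (right_mem_Icc.2 hab)).2.2.le fun s hs hsI =>
      (hsub (Ioo_subset_Icc_self hsI)).1 hs).contMDiffAt hnhds

theorem IsPiecewiseSmooth.concat (h : IsPiecewiseSmooth (n := n) γ)
    (h' : IsPiecewiseSmooth (n := n) γ') (hγ : γ 1 = γ' 0) :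
    IsPiecewiseSmooth (n := n) (concat γ γ') := by
  classical
  obtain ⟨F, hF⟩ := h
  obtain ⟨F', hF'⟩ := h'
  refine ⟨insert (1 / 2) (F.image (fun t => t / 2) ∪ F'.image (fun t => (t + 1) / 2)),
    fun a b ha hab hb hab' => ?_⟩
  simp only [Finset.mem_insert, Finset.mem_union, Finset.mem_image, or_imp,
    forall_and, forall_eq, forall_exists_index, and_imp, forall_apply_eq_imp_iff₂] at hab'
  obtain ⟨hhalf, hF₁, hF₂⟩ := hab'
  rw [mem_Ioo, not_and_or, not_lt, not_lt] at hhalf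
  rcases hhalf with hhalf | hhalf
  · refine ((hF' (2 * a - 1) (2 * b - 1) (by linarith) (by linarith) (by linarith)
      fun t ht ht' => hF₂ t ht ⟨by linarith [ht'.1], by linarith [ht'.2]⟩).comp
      (f := fun t => 2 * t - 1) (ContDiff.contMDiff (by fun_prop)).contMDiffOn
      fun t ht => ⟨by linarith [ht.1], by linarith [ht.2]⟩).congr
      fun t ht => concat_of_half_le hγ (hhalf.trans ht.1)
  · refine ((hF (2 * a) (2 * b) (by linarith) (by linarith) (by linarith)
      fun t ht ht' => hF₁ t ht ⟨by linarith [ht'.1], by linarith [ht'.2]⟩).comp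
      (f := fun t => 2 * t) (ContDiff.contMDiff (by fun_prop)).contMDiffOn
      fun t ht => ⟨by linarith [ht.1], by linarith [ht.2]⟩).congr
      fun t ht => concat_of_le_half (ht.2.trans hhalf)

theorem IsPiecewiseSmooth.reverse (h : IsPiecewiseSmooth (n := n) γ) :
    IsPiecewiseSmooth (n := n) fun t => γ (1 - t) := by
  classical
  obtain ⟨F, hF⟩ := h
  refine ⟨F.image (fun t => 1 - t), fun a b ha hab hb hab' => ?_⟩
  refine (hF (1 - b) (1 - a) (by linarith) (by linarith) (by linarith) fun t ht ht' => ?_).comp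
    (ContDiff.contMDiff (by fun_prop)).contMDiffOn
    fun t ht => ⟨by linarith [ht.2], by linarith [ht.1]⟩
  exact hab' (1 - t) (Finset.mem_image_of_mem _ ht) ⟨by linarith [ht'.2], by linarith [ht'.1]⟩

variable {τ τ' : ℝ → Tractor n}

theorem tractorCurve_congr {s t : ℝ} (hγ : γ s = γ' t) (hτ : τ s = τ' t) :
    tractorCurve γ τ s = tractorCurve γ' τ' t := by
  rw [tractorCurve, tractorCurve, hτ, hγ]

theorem tractorCurve_concat : tractorCurve (concat γ γ') (concat τ τ') =
    concat (tractorCurve γ τ) (tractorCurve γ' τ') := by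
  funext t
  rcases le_or_gt t (1 / 2) with ht | ht
  · rw [concat_of_le_half ht]
    exact tractorCurve_congr (concat_of_le_half ht) (concat_of_le_half ht)
  · rw [concat, if_neg ht.not_ge]
    exact tractorCurve_congr (if_neg ht.not_ge) (if_neg ht.not_ge)

end Curves

section Transport

variable {n p q : ℕ} {M : Type*} [TopologicalSpace M] [ChartedSpace (E n) M]
  [IsManifold (𝓡 n) ∞ M] {g : Metric n p q M}

section Along

variable {γ γ' : ℝ → M} {τ τ' : ℝ → Tractor n}

theorem IsParallelAlong.congr (h : IsParallelAlong g γ τ) (hγ : EqOn γ' γ (Icc 0 1)) :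
    IsParallelAlong g γ' τ := by
  obtain ⟨hc, F, hF⟩ := isParallelAlong_iff.1 h
  refine isParallelAlong_iff.2 ⟨hc.congr fun t ht => tractorCurve_congr (hγ ht) rfl, F,
    fun t ht htF => (hF t ht htF).congr ?_ .rfl⟩
  filter_upwards [Icc_mem_nhds ht.1 ht.2] with s hs using hγ hs

theorem IsParallelAlong.concat (h : IsParallelAlong g γ τ) (h' : IsParallelAlong g γ' τ')
    (hγ : γ 1 = γ' 0) (hτ : τ 1 = τ' 0) : IsParallelAlong g (concat γ γ') (concat τ τ') := by
  classical
  obtain ⟨hc, F, hF⟩ := isParallelAlong_iff.1 h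
  obtain ⟨hc', F', hF'⟩ := isParallelAlong_iff.1 h'
  refine isParallelAlong_iff.2 ⟨?_, insert (1 / 2)
    (F.image (fun t => t / 2) ∪ F'.image (fun t => (t + 1) / 2)), fun t ht htF => ?_⟩
  · rw [tractorCurve_concat]
    exact continuousOn_concat hc hc' (tractorCurve_congr hγ hτ)
  simp only [Finset.mem_insert, Finset.mem_union, Finset.mem_image, not_or] at htF
  obtain ⟨hne, htF, htF'⟩ := htF
  rcases lt_or_gt_of_ne hne with hlt | hlt
  · have hp : IsParallelAt g γ τ (2 * t + 0) :=
      hF _ ⟨by linarith [ht.1], by linarith⟩ fun hm => htF ⟨_, hm, by ring⟩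
    refine hp.comp_affine.congr ?_ ?_ <;> filter_upwards [Iio_mem_nhds hlt] with s hs <;>
      rw [concat_of_le_half (le_of_lt hs), add_zero]
  · have hp : IsParallelAt g γ' τ' (2 * t + (-1)) :=
      hF' _ ⟨by linarith, by linarith [ht.2]⟩ fun hm => htF' ⟨_, hm, by ring⟩
    refine hp.comp_affine.congr ?_ ?_ <;> filter_upwards [Ioi_mem_nhds hlt] with s hs
    · rw [concat_of_half_le hγ (le_of_lt hs), sub_eq_add_neg]
    · rw [concat_of_half_le hτ (le_of_lt hs), sub_eq_add_neg]

theorem IsParallelAlong.reverse (h : IsParallelAlong g γ τ) :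
    IsParallelAlong g (fun t => γ (1 - t)) (fun t => τ (1 - t)) := by
  classical
  obtain ⟨hc, F, hF⟩ := isParallelAlong_iff.1 h
  refine isParallelAlong_iff.2 ⟨hc.comp (f := fun t => 1 - t) (by fun_prop)
    fun t ht => ⟨by linarith [ht.2], by linarith [ht.1]⟩, F.image (fun t => 1 - t),
    fun t ht htF => ?_⟩
  have hp : IsParallelAt g γ τ ((-1) * t + 1) :=
    hF _ ⟨by linarith [ht.2], by linarith [ht.1]⟩ fun hm =>
      htF (Finset.mem_image.2 ⟨_, hm, by ring⟩)
  refine hp.comp_affine.congr ?_ ?_ <;> filter_upwards with s <;> ring_nf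

theorem IsParallelAlong.tractorMetric_eq (hγ : IsPiecewiseSmooth (n := n) γ)
    (h : IsParallelAlong g γ τ) (h' : IsParallelAlong g γ τ') :
    tractorMetric g (γ 1) (τ 1) (τ' 1) = tractorMetric g (γ 0) (τ 0) (τ' 0) := by
  obtain ⟨hc, F, hF⟩ := isParallelAlong_iff.1 h
  obtain ⟨hc', F', hF'⟩ := isParallelAlong_iff.1 h'
  obtain ⟨F'', hF''⟩ := hγ.exists_finset
  have hintegral := MeasureTheory.integral_eq_of_hasDerivAt_off_countable_of_le
    (fun t => tractorMetric g (γ t) (τ t) (τ' t)) (fun _ => 0) zero_le_one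
    (s := F ∪ F' ∪ F'')
    ((F.countable_toSet.union F'.countable_toSet).union F''.countable_toSet)
    (continuousOn_tractorMetric hc hc') (fun t ⟨ht, htF⟩ => ?_) (by simp)
  · rw [intervalIntegral.integral_zero] at hintegral
    linarith
  · simp only [mem_union, Finset.mem_coe, not_or] at htF
    have hsmooth := hF'' t ht htF.2
    refine hasDerivAt_tractorMetric hsmooth.continuousAt ?_ (hF t ht htF.1.1) (hF' t ht htF.1.2)
    exact ((mdifferentiableAt_extChartAt (I := 𝓡 n) (mem_chart_source (E n) (γ t))).comp t
      (hsmooth.mdifferentiableAt (by simp))).differentiableAt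

end Along

variable {x y z : M} {γ : Path x y} {γ' : Path y z} {A B : Tractor n →L[ℝ] Tractor n}

/-- `A` is the parallel transport of tractors along the piecewise smooth path `γ`. -/
def IsTransport (g : Metric n p q M) (γ : Path x y) (A : Tractor n →L[ℝ] Tractor n) : Prop :=
  IsPiecewiseSmooth (n := n) γ.extend ∧ ∀ v : Tractor n, ∃ τ : ℝ → Tractor n,
    IsParallelAlong g γ.extend τ ∧ τ 0 = v ∧ τ 1 = A v

theorem IsTransport.isometry (h : IsTransport g γ A) (v w : Tractor n) :
    tractorMetric g y (A v) (A w) = tractorMetric g x v w := by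
  obtain ⟨τ, hτ, h0, h1⟩ := h.2 v
  obtain ⟨τ', hτ', h0', h1'⟩ := h.2 w
  simpa only [h0, h1, h0', h1', Path.extend_zero, Path.extend_one] using
    hτ.tractorMetric_eq h.1 hτ'

theorem isTransport_refl (g : Metric n p q M) (x : M) : IsTransport g (Path.refl x) 1 := by
  refine ⟨⟨∅, fun _ _ _ _ _ _ => contMDiffOn_const⟩, fun v => ⟨fun _ => v,
    isParallelAlong_iff.2 ⟨continuousOn_const (c := ((v.1, ⟨x, v.2.1⟩, v.2.2) :
      ℝ × TangentBundle (𝓡 n) M × ℝ)), ∅, fun t _ _ => ?_⟩, rfl, rfl⟩⟩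
  rw [isParallelAt_iff]
  simpa using hasDerivAt_const t (tractorMap (chartD x x) v)

theorem IsTransport.trans (h : IsTransport g γ A) (h' : IsTransport g γ' B) :
    IsTransport g (γ.trans γ') (B * A) := by
  have hγ : γ.extend 1 = γ'.extend 0 := by simp
  rw [IsTransport, extend_trans_eq_concat]
  refine ⟨h.1.concat h'.1 hγ, fun v => ?_⟩
  obtain ⟨τ, hτ, h0, h1⟩ := h.2 v
  obtain ⟨τ', hτ', h0', h1'⟩ := h'.2 (A v)
  exact ⟨concat τ τ', hτ.concat hτ' hγ (h1.trans h0'.symm), concat_zero.trans h0,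
    concat_one.trans h1'⟩

theorem IsTransport.symm {A : Tractor n ≃L[ℝ] Tractor n} (h : IsTransport g γ A) :
    IsTransport g γ.symm (A.symm : Tractor n →L[ℝ] Tractor n) := by
  have hγ : γ.symm.extend = fun t => γ.extend (1 - t) := funext (Path.extend_symm_apply γ)
  rw [IsTransport, hγ]
  refine ⟨h.1.reverse, fun v => ?_⟩
  obtain ⟨τ, hτ, h0, h1⟩ := h.2 (A.symm v)
  exact ⟨_, hτ.reverse, by simpa using h1, by simpa using h0⟩

theorem mem_holonomy0 : A ∈ holonomy0 g x ↔
    ∃ γ : Path x x, IsTransport g γ A ∧ γ.Homotopic (Path.refl x) :=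
  ⟨fun ⟨γ, hγ, hhom, hA⟩ => ⟨γ, ⟨hγ, hA⟩, hhom⟩, fun ⟨γ, ⟨hγ, hA⟩, hhom⟩ => ⟨γ, hγ, hhom, hA⟩⟩

/-- The restricted holonomy group as a submonoid of the endomorphisms of the fibre: its elements
are linear maps, not units of the endomorphism ring. -/
def holonomySubmonoid (g : Metric n p q M) (x : M) : Submonoid (Tractor n →L[ℝ] Tractor n) where
  carrier := holonomy0 g x
  one_mem' := mem_holonomy0.2 ⟨_, isTransport_refl g x, .refl _⟩
  mul_mem' hA hB := by
    obtain ⟨γ, hγ, hhom⟩ := mem_holonomy0.1 hA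
    obtain ⟨δ, hδ, hhom'⟩ := mem_holonomy0.1 hB
    exact mem_holonomy0.2 ⟨δ.trans γ, hδ.trans hγ, by simpa using hhom'.hcomp hhom⟩

theorem isometry_of_mem_holonomy0 (hA : A ∈ holonomy0 g x) (v w : Tractor n) :
    tractorMetric g x (A v) (A w) = tractorMetric g x v w := by
  obtain ⟨γ, hγ, -⟩ := mem_holonomy0.1 hA
  exact hγ.isometry v w

theorem IsTransport.conj_mem_holonomy0 {P : Tractor n ≃L[ℝ] Tractor n} (h : IsTransport g γ P)
    (hA : A ∈ holonomy0 g y) :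
    (P.symm : Tractor n →L[ℝ] Tractor n) ∘L A ∘L (P : Tractor n →L[ℝ] Tractor n)
      ∈ holonomy0 g x := by
  obtain ⟨δ, hδ, hhom⟩ := mem_holonomy0.1 hA
  refine mem_holonomy0.2 ⟨(γ.trans δ).trans γ.symm, (h.trans hδ).trans h.symm, ?_⟩
  have h₁ : ((γ.trans δ).trans γ.symm).Homotopic ((γ.trans (Path.refl y)).trans γ.symm) :=
    ((Path.Homotopic.refl γ).hcomp hhom).hcomp (.refl _)
  have h₂ : ((γ.trans (Path.refl y)).trans γ.symm).Homotopic (γ.trans γ.symm) :=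
    Path.Homotopic.hcomp ⟨Path.Homotopy.transRefl γ⟩ (.refl _)
  exact (h₁.trans h₂).trans ⟨(Path.Homotopy.reflTransSymm γ).symm⟩

end Transport

section LocalTransport

variable {n p q : ℕ} {M : Type*} [TopologicalSpace M] [ChartedSpace (E n) M]

section ChartLine

variable {x₀ : M} {ξ : E n}

/-- The curve in `M` which in the chart at `x₀` is the segment from the image of `x₀` in
direction `ξ`. -/
def chartLine (x₀ : M) (ξ : E n) (t : ℝ) : M :=
  (extChartAt (𝓡 n) x₀).symm (extChartAt (𝓡 n) x₀ x₀ + t • ξ)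

theorem chartLine_zero : chartLine x₀ ξ 0 = x₀ := by
  rw [chartLine, zero_smul, add_zero, extChartAt_to_inv]

theorem chartLine_one :
    chartLine x₀ ξ 1 = (extChartAt (𝓡 n) x₀).symm (extChartAt (𝓡 n) x₀ x₀ + ξ) := by
  rw [chartLine, one_smul]

theorem extChartAt_chartLine {t : ℝ}
    (ht : extChartAt (𝓡 n) x₀ x₀ + t • ξ ∈ (extChartAt (𝓡 n) x₀).target) :
    extChartAt (𝓡 n) x₀ (chartLine x₀ ξ t) = extChartAt (𝓡 n) x₀ x₀ + t • ξ :=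
  (extChartAt (𝓡 n) x₀).right_inv ht

variable [IsManifold (𝓡 n) ∞ M]

theorem contMDiffOn_chartLine {s : Set ℝ}
    (hξ : ∀ t ∈ s, extChartAt (𝓡 n) x₀ x₀ + t • ξ ∈ (extChartAt (𝓡 n) x₀).target) :
    ContMDiffOn 𝓘(ℝ, ℝ) (𝓡 n) ∞ (chartLine x₀ ξ) s :=
  (contMDiffOn_extChartAt_symm x₀).comp (f := fun t : ℝ => extChartAt (𝓡 n) x₀ x₀ + t • ξ)
    (ContDiff.contMDiff (by fun_prop)).contMDiffOn hξ

variable {g : Metric n p q M} {U : ℝ → Tractor n →L[ℝ] Tractor n}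

theorem isParallelAlong_chartLine
    (hξ : ∀ t ∈ Icc (0 : ℝ) 1, extChartAt (𝓡 n) x₀ x₀ + t • ξ ∈ (extChartAt (𝓡 n) x₀).target)
    (hU : IsFundamental (tractorForm (coordMetric g x₀)) (extChartAt (𝓡 n) x₀ x₀) ξ U)
    (v : Tractor n) :
    IsParallelAlong g (chartLine x₀ ξ)
      fun t => tractorMap (chartDInv x₀ (extChartAt (𝓡 n) x₀ x₀ + t • ξ)) (U t v) := by
  have hf := (contMDiffOn_chartLine hξ).continuousOn
  have hsource (t) (ht : t ∈ Icc (0 : ℝ) 1) :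
      chartLine x₀ ξ t ∈ (extChartAt (𝓡 n) x₀).source :=
    (extChartAt (𝓡 n) x₀).map_target (hξ t ht)
  have hfield (t) (ht : t ∈ Icc (0 : ℝ) 1) : tractorMap (chartD x₀ (chartLine x₀ ξ t))
      (tractorMap (chartDInv x₀ (extChartAt (𝓡 n) x₀ x₀ + t • ξ)) (U t v)) = U t v :=
    tractorMap_chartD_chartDInv (hξ t ht) _
  have hderiv (t) (ht : t ∈ Icc (0 : ℝ) 1) : HasDerivWithinAt (fun t => U t v)
      (-tractorForm (coordMetric g x₀) (extChartAt (𝓡 n) x₀ x₀ + t • ξ) ξ (U t v))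
      (Icc 0 1) t := by
    simpa using (hU.2 t ht).clm_apply (hasDerivWithinAt_const t (Icc 0 1) v)
  refine isParallelAlong_iff.2 ⟨fun t ht => (continuousWithinAt_tractorCurve_iff (hsource t ht)).2
    ⟨hf t ht, (hderiv t ht).continuousWithinAt.congr hfield (hfield t ht)⟩, ∅, fun t ht _ => ?_⟩
  have hnear : Icc (0 : ℝ) 1 ∈ 𝓝 t := Icc_mem_nhds ht.1 ht.2
  replace ht := Ioo_subset_Icc_self ht
  have hline : HasDerivAt (fun t : ℝ => extChartAt (𝓡 n) x₀ x₀ + t • ξ) ξ t := by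
    simpa using ((hasDerivAt_id t).smul_const ξ).const_add (extChartAt (𝓡 n) x₀ x₀)
  refine isParallelAt_of_chart (c' := ξ) (hsource t ht) (hf.continuousAt hnear)
    (hline.congr_of_eventuallyEq ?_) ?_
  · filter_upwards [hnear] with s hs using extChartAt_chartLine (hξ s hs)
  · rw [extChartAt_chartLine (hξ t ht), hfield t ht]
    refine ((hderiv t ht).hasDerivAt hnear).congr_of_eventuallyEq ?_
    filter_upwards [hnear] with s hs using hfield s hs

theorem exists_isTransport_chartLine
    (hξ : ∀ t ∈ Icc (0 : ℝ) 1, extChartAt (𝓡 n) x₀ x₀ + t • ξ ∈ (extChartAt (𝓡 n) x₀).target)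
    (hU : IsFundamental (tractorForm (coordMetric g x₀)) (extChartAt (𝓡 n) x₀ x₀) ξ U) :
    ∃ γ : Path x₀ ((extChartAt (𝓡 n) x₀).symm (extChartAt (𝓡 n) x₀ x₀ + ξ)),
      IsTransport g γ (tractorMap (chartDInv x₀ (extChartAt (𝓡 n) x₀ x₀ + ξ)) ∘L U 1) := by
  have hf := contMDiffOn_chartLine hξ
  let γ := Path.ofLine hf.continuousOn chartLine_zero chartLine_one
  have hγ : EqOn γ.extend (chartLine x₀ ξ) (Icc 0 1) := fun t ht => Path.extend_apply γ ht
  refine ⟨γ, ⟨∅, fun a b ha _ hb _ => (hf.congr hγ).mono (Icc_subset_Icc ha hb)⟩,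
    fun v => ⟨_, (isParallelAlong_chartLine hξ hU v).congr hγ, ?_, by simp⟩⟩
  rw [hU.1, zero_smul, add_zero]
  simpa [tractorMap_chartD_self] using
    tractorMap_chartDInv_chartD (mem_extChartAt_source (I := 𝓡 n) x₀) v

end ChartLine

theorem IsFundamental.eq_one {V R : Type*} [NormedAddCommGroup V] [NormedSpace ℝ V]
    [NormedRing R] [NormedAlgebra ℝ R] {B : V → V →L[ℝ] R} {y₀ : V} {U : ℝ → R}
    (h : IsFundamental B y₀ 0 U) : U 1 = 1 := by
  have hle := norm_image_sub_le_of_norm_deriv_le_segment_01' (C := 0) h.2 (by simp)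
  rwa [norm_le_zero_iff, sub_eq_zero, h.1] at hle

variable [IsManifold (𝓡 n) ∞ M]

theorem IsTransport.injective {g : Metric n p q M} {x y : M} {γ : Path x y}
    {A : Tractor n →L[ℝ] Tractor n} (h : IsTransport g γ A) : Function.Injective A :=
  (isScalarProduct_metricAt g x).tractorBil.injective_of_isometry
    (h' := tractorBil (metricAt g y)) h.isometry

theorem exists_equiv_isTransport_chartLine {g : Metric n p q M} {x₀ : M} {ξ : E n}
    {U : ℝ → Tractor n →L[ℝ] Tractor n}
    (hξ : ∀ t ∈ Icc (0 : ℝ) 1, extChartAt (𝓡 n) x₀ x₀ + t • ξ ∈ (extChartAt (𝓡 n) x₀).target)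
    (hU : IsFundamental (tractorForm (coordMetric g x₀)) (extChartAt (𝓡 n) x₀ x₀) ξ U) :
    ∃ P : Tractor n ≃L[ℝ] Tractor n,
      (∃ γ : Path x₀ ((extChartAt (𝓡 n) x₀).symm (extChartAt (𝓡 n) x₀ x₀ + ξ)),
        IsTransport g γ P) ∧
      P.symm (sMinus n) = Ring.inverse (U 1) (sMinus n) := by
  set C := tractorMap (chartDInv x₀ (extChartAt (𝓡 n) x₀ x₀ + ξ))
  obtain ⟨γ, hγ⟩ := exists_isTransport_chartLine hξ hU
  have hy : extChartAt (𝓡 n) x₀ x₀ + ξ ∈ (extChartAt (𝓡 n) x₀).target := by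
    simpa using hξ 1 (by simp)
  have hinjU : Function.Injective (U 1) := .of_comp (f := C) hγ.injective
  have hinjC : Function.Injective C :=
    Function.LeftInverse.injective (tractorMap_chartD_chartDInv hy)
  let eU := (LinearEquiv.ofInjectiveEndo (U 1 : Tractor n →ₗ[ℝ] Tractor n)
    hinjU).toContinuousLinearEquiv
  let eC := (LinearEquiv.ofInjectiveEndo (C : Tractor n →ₗ[ℝ] Tractor n)
    hinjC).toContinuousLinearEquiv
  have heU : (eU : Tractor n →L[ℝ] Tractor n) = U 1 := rfl
  have heC : eC (sMinus n) = sMinus n := by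
    change C (sMinus n) = sMinus n
    simp [C, tractorMap_apply, sMinus]
  refine ⟨eU.trans eC, ⟨γ, hγ⟩, ?_⟩
  rw [← heU, ContinuousLinearMap.ringInverse_equiv, ContinuousLinearMap.inverse_equiv]
  exact congrArg eU.symm (eC.symm_apply_eq.2 heC.symm)

theorem exists_local_transport (g : Metric n p q M) (x₀ : M) :
    ∃ P : E n → Tractor n ≃L[ℝ] Tractor n,
      (∀ᶠ ξ in 𝓝 0, ∃ γ : Path x₀ ((extChartAt (𝓡 n) x₀).symm (extChartAt (𝓡 n) x₀ x₀ + ξ)),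
        IsTransport g γ (P ξ)) ∧
      (P 0).symm (sMinus n) = sMinus n ∧
      HasStrictFDerivAt (fun ξ => (P ξ).symm (sMinus n))
        ((ContinuousLinearMap.inr ℝ ℝ (E n × ℝ)).comp (ContinuousLinearMap.inl ℝ (E n) ℝ)) 0 := by
  set y₀ := extChartAt (𝓡 n) x₀ x₀
  have hG := isMetricOn_coordMetric g x₀
  have htarget := (isOpen_extChartAt_target (I := 𝓡 n) x₀).mem_nhds (mem_extChartAt_target x₀)
  obtain ⟨U, hU, hstrict⟩ := exists_fundamental_family
    ((hG.contDiffOn_tractorForm.contDiffAt htarget).of_le (by simp))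
  obtain ⟨r, hr, hball⟩ := Metric.mem_nhds_iff.1 htarget
  have hP : ∀ᶠ ξ in 𝓝 (0 : E n), ∃ P : Tractor n ≃L[ℝ] Tractor n,
      (∃ γ : Path x₀ ((extChartAt (𝓡 n) x₀).symm (y₀ + ξ)), IsTransport g γ P) ∧
      P.symm (sMinus n) = Ring.inverse (U ξ 1) (sMinus n) := by
    filter_upwards [hU, Metric.ball_mem_nhds (0 : E n) hr] with ξ hUξ hξ
    have hseg := fun t ht => hball (add_smul_mem_ball (mem_ball_zero_iff.1 hξ) (t := t) ht)
    exact exists_equiv_isTransport_chartLine hseg hUξ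
  have hU0 : U 0 1 = 1 := hU.self_of_nhds.eq_one
  obtain ⟨P, hP⟩ := hP.choice
  refine ⟨P, hP.mono fun ξ h => h.1, ?_, ?_⟩
  · rw [hP.self_of_nhds.2, hU0, Ring.inverse_one]
    rfl
  · have hinv := (hasStrictFDerivAt_ringInverse_of_eq_one hstrict hU0).clm_apply
      (hasStrictFDerivAt_const (sMinus n) (0 : E n))
    refine (hinv.congr_of_eventuallyEq (hP.mono fun ξ h => h.2.symm)).congr_fderiv ?_
    ext1 ξ
    simp [tractorForm_sMinus]

end LocalTransport

section ChartParam

variable {n : ℕ} {M : Type*} [TopologicalSpace M] [ChartedSpace (E n) M]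

/-- The chart at `x₀`, centred at `x₀` and read as a local parametrization of `M` by `ℝⁿ`. -/
def chartParam (x₀ : M) : OpenPartialHomeomorph (E n) M :=
  (Homeomorph.addLeft (extChartAt (𝓡 n) x₀ x₀)).transOpenPartialHomeomorph (chartAt (E n) x₀).symm

theorem chartParam_apply (x₀ : M) (ξ : E n) :
    chartParam x₀ ξ = (extChartAt (𝓡 n) x₀).symm (extChartAt (𝓡 n) x₀ x₀ + ξ) := rfl

theorem zero_mem_chartParam_source (x₀ : M) : (0 : E n) ∈ (chartParam x₀).source := by
  simp [chartParam]

theorem chartParam_zero (x₀ : M) : chartParam x₀ (0 : E n) = x₀ := by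
  rw [chartParam_apply, add_zero, extChartAt_to_inv]

end ChartParam

theorem hasStrictFDerivAt_inv_smul {n : ℕ} {V : Type*} [NormedAddCommGroup V] [NormedSpace ℝ V]
    {f : V → Tractor n} {f' : V →L[ℝ] E n} {x : V}
    (hf : HasStrictFDerivAt f ((ContinuousLinearMap.inr ℝ ℝ (E n × ℝ)).comp
      ((ContinuousLinearMap.inl ℝ (E n) ℝ).comp f')) x) (hfx : f x = sMinus n) :
    HasStrictFDerivAt (fun ξ => (f ξ).1⁻¹ • (f ξ).2.1) f' x := by
  have hfst : HasStrictFDerivAt (fun ξ => (f ξ).1) (0 : V →L[ℝ] ℝ) x := hf.fst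
  have hmid : HasStrictFDerivAt (fun ξ => (f ξ).2.1) f' x := hf.snd.fst
  have hinv := (hasStrictDerivAt_inv (x := (f x).1) (by simp [hfx, sMinus])).hasStrictFDerivAt.comp
    x hfst
  refine (hinv.smul hmid).congr_fderiv ?_
  ext v : 1
  simp [hfx, sMinus]

section HolonomyAlgebra

variable {n p q : ℕ} {M : Type*} [TopologicalSpace M] [ChartedSpace (E n) M]
  [IsManifold (𝓡 n) ∞ M] {g : Metric n p q M} {x y : M} {γ : Path x y}
  {P : Tractor n ≃L[ℝ] Tractor n}

theorem IsTransport.conj_mem_holAlg (h : IsTransport g γ P) {A : Tractor n →L[ℝ] Tractor n}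
    (hA : A ∈ holAlg g y) :
    (P.symm : Tractor n →L[ℝ] Tractor n) ∘L A ∘L (P : Tractor n →L[ℝ] Tractor n) ∈ holAlg g x :=
  map_mem_span_velocities
    (φ := (P.symm.arrowCongr P.symm : (Tractor n →L[ℝ] Tractor n) →L[ℝ] Tractor n →L[ℝ] Tractor n))
    (by ext u <;> simp) (fun _ ha => h.conj_mem_holonomy0 ha) hA

theorem exists_wedge_sMinus_mem_holAlg (h : rankE g y ≠ 0) :
    ∃ k, tractorBil (metricAt g y) (sMinus n) k = 0 ∧ (∀ r : ℝ, k ≠ r • sMinus n) ∧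
      wedge (tractorBil (metricAt g y)) (sMinus n) k ∈ holAlg g y := by
  have hbot : holDistribution g y ≠ ⊥ := fun hbot => h (by
    rw [rankE, hbot]
    exact finrank_bot ℝ (E n))
  rw [holDistribution, Ne, Submodule.span_eq_bot] at hbot
  push Not at hbot
  obtain ⟨X, ⟨A, hA, hAs, hperp, τ, rfl⟩, hX⟩ := hbot
  have hskew : ∀ u v, tractorBil (metricAt g y) (A u) v = -tractorBil (metricAt g y) u (A v) :=
    skew_of_mem_span_velocities (fun a ha => isometry_of_mem_holonomy0 ha) hA
  have hwedge := eq_wedge_of_skew (e := (0, 0, 1)) (isScalarProduct_metricAt g y).tractorBil hskew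
    (tractorBil_sMinus _ _) hperp
  refine ⟨A (0, 0, 1), ?_, fun r hr => hX ?_, hwedge ▸ hA⟩
  · rw [← neg_eq_zero, ← hskew, hAs, map_zero, zero_apply]
  · rw [hwedge, hr, map_smul, wedge_self, smul_zero]
    rfl

theorem IsTransport.exists_wedge_nullVec_mem_holAlg (h : IsTransport g γ P) (hy : rankE g y ≠ 0)
    (hs : (P.symm (sMinus n)).1 ≠ 0) :
    ∃ w ≠ 0, wedge (tractorBil (metricAt g x))
      (nullVec (metricAt g x) ((P.symm (sMinus n)).1⁻¹ • (P.symm (sMinus n)).2.1))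
      (nullTangent (metricAt g x) ((P.symm (sMinus n)).1⁻¹ • (P.symm (sMinus n)).2.1) w)
        ∈ holAlg g x := by
  obtain ⟨k, hk, hks, hmem⟩ := exists_wedge_sMinus_mem_holAlg hy
  have hiso : ∀ u v, tractorBil (metricAt g y) (P u) (P v) = tractorBil (metricAt g x) u v :=
    h.isometry
  have hiso' (u v) : tractorBil (metricAt g x) (P.symm u) (P.symm v) =
      tractorBil (metricAt g y) u v := by simp [← hiso]
  obtain ⟨w, hw, heq⟩ := exists_wedge_eq_smul_wedge_nullVec
    (by rw [hiso', tractorBil_sMinus]; rfl) hs (by rw [hiso', hk])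
    fun r hr => hks r (P.symm.injective (by rw [hr, map_smul]))
  refine ⟨w, hw, ((holAlg g x).smul_mem_iff hs).1 ?_⟩
  rw [← heq, ← symm_comp_wedge_comp P hiso]
  exact h.conj_mem_holAlg hmem

theorem zero_mem_interior_closure_wedge_nullVec (g : Metric n p q M) {x₀ : M}
    (hx₀ : x₀ ∈ interior (closure {y | rankE g y ≠ 0})) :
    (0 : E n) ∈ interior (closure {z | ∃ w ≠ 0, wedge (tractorBil (metricAt g x₀))
      (nullVec (metricAt g x₀) z) (nullTangent (metricAt g x₀) z w) ∈ holAlg g x₀}) := by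
  obtain ⟨P, hP, hP0, hPderiv⟩ := exists_local_transport g x₀
  have hdirection := hasStrictFDerivAt_inv_smul
    (f' := (ContinuousLinearEquiv.refl ℝ (E n) : E n →L[ℝ] E n)) hPderiv hP0
  let Φ := hdirection.toOpenPartialHomeomorph
  have hΦ0 : Φ 0 = 0 := by
    change ((P 0).symm (sMinus n)).1⁻¹ • ((P 0).symm (sMinus n)).2.1 = 0
    rw [hP0]
    simp [sMinus]
  rw [← chartParam_zero (n := n) x₀,
    mem_interior_closure_iff_preimage _ (zero_mem_chartParam_source x₀)] at hx₀
  have hs : ∀ᶠ ξ in 𝓝 (0 : E n), ((P ξ).symm (sMinus n)).1 ≠ 0 :=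
    hPderiv.continuousAt.fst.eventually_ne (by rw [hP0]; simp [sMinus])
  convert! (mem_interior_closure_iff_preimage Φ
    hdirection.mem_toOpenPartialHomeomorph_source).2
      (mem_interior_closure_of_eventually_imp hx₀ ?_) using 1
  · exact hΦ0.symm
  filter_upwards [hP, hs] with ξ ⟨γ, hγ⟩ hs hξ
  exact hγ.exists_wedge_nullVec_mem_holAlg hξ hs

end HolonomyAlgebra

section OpenOrbit

variable {n p q : ℕ}

/-- The projection `(α, Y, β) ↦ (α, Y)`, a local coordinate system on the null cone where
`α ≠ 0`. -/
def dropLast (n : ℕ) : Tractor n →L[ℝ] ℝ × E n :=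
  (ContinuousLinearMap.fst ℝ ℝ (E n × ℝ)).prod
    ((ContinuousLinearMap.fst ℝ (E n) ℝ).comp (ContinuousLinearMap.snd ℝ ℝ (E n × ℝ)))

theorem eq_of_dropLast_eq {b : Bil n} {u v : Tractor n} (hu : tractorBil b u u = 0)
    (hv : tractorBil b v v = 0) (hu1 : u.1 ≠ 0) (h : dropLast n u = dropLast n v) : u = v := by
  obtain ⟨hfst, hmid⟩ := Prod.ext_iff.1 h
  change u.1 = v.1 at hfst
  change u.2.1 = v.2.1 at hmid
  rw [tractorBil_apply] at hu hv
  rw [← hfst, ← hmid] at hv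
  have hlast : u.1 * u.2.2 = u.1 * v.2.2 := by linarith
  exact Prod.ext hfst (Prod.ext hmid (mul_left_cancel₀ hu1 hlast))

theorem exists_dropLast_eq_of_tractorBil_nullVec (b : Bil n) (y : E n) (z : ℝ × E n) :
    ∃ u, tractorBil b (nullVec b y) u = 0 ∧ dropLast n u = z := by
  refine ⟨(z.1, z.2, z.1 * (1 / 2 * b y y) - b y z.2), ?_, rfl⟩
  simp only [tractorBil_apply, nullVec]
  ring

variable {M : Type*} [TopologicalSpace M] [ChartedSpace (E n) M] [IsManifold (𝓡 n) ∞ M]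
  {g : Metric n p q M} {x y : M}

theorem span_dropLast_velocities_eq_top {z : E n}
    (h : ∀ u, tractorBil (metricAt g x) (nullVec (metricAt g x) z) u = 0 →
      u ∈ orbitTangent (holAlg g x) (nullVec (metricAt g x) z)) :
    Submodule.span ℝ ((dropLast n ∘L ContinuousLinearMap.apply ℝ (Tractor n)
      (nullVec (metricAt g x) z)) '' velocities (holonomySubmonoid g x : Set _)) = ⊤ := by
  refine eq_top_iff.2 fun a _ => ?_
  obtain ⟨u, hu, rfl⟩ := exists_dropLast_eq_of_tractorBil_nullVec (metricAt g x) z a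
  obtain ⟨A, hA, rfl⟩ := h u hu
  have hmem := Submodule.mem_map_of_mem (f := (dropLast n ∘L ContinuousLinearMap.apply ℝ (Tractor n)
    (nullVec (metricAt g x) z) : _ →L[ℝ] ℝ × E n).toLinearMap) hA
  rw [holAlg, Submodule.map_span] at hmem
  exact hmem

theorem eventually_mem_orbit {z : E n}
    (h : ∀ u, tractorBil (metricAt g x) (nullVec (metricAt g x) z) u = 0 →
      u ∈ orbitTangent (holAlg g x) (nullVec (metricAt g x) z)) :
    ∀ᶠ u in 𝓝 (nullVec (metricAt g x) z), tractorMetric g x u u = 0 →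
      ∃ A ∈ holonomy0 g x, A (nullVec (metricAt g x) z) = u := by
  have hproj := eventually_exists_mem_apply_eq _ (span_dropLast_velocities_eq_top h)
  have hfst : ∀ᶠ u : Tractor n in 𝓝 (nullVec (metricAt g x) z), u.1 ≠ 0 :=
    continuous_fst.continuousAt.eventually_ne one_ne_zero
  filter_upwards [(dropLast n).continuous.continuousAt.eventually hproj, hfst]
    with u ⟨A, hA, hAu⟩ hu1 hu
  have hnull := (isometry_of_mem_holonomy0 hA (nullVec (metricAt g x) z) _).trans
    (tractorBil_nullVec_self _ _)
  exact ⟨A, hA, (eq_of_dropLast_eq hu hnull hu1 hAu.symm).symm⟩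

/-- Some orbit of `Hol⁰_x` in the null cone of `𝒯_x` is open; unlike `HasOpenOrbit`, this refers
to a single point and to no tractor frame. -/
def HasOpenNullOrbit (g : Metric n p q M) (x : M) : Prop :=
  ∃ v : Tractor n, v ≠ 0 ∧ tractorMetric g x v v = 0 ∧ ∀ A₀ ∈ holonomy0 g x,
    ∀ᶠ u in 𝓝 (A₀ v), tractorMetric g x u u = 0 → ∃ A ∈ holonomy0 g x, A v = u

theorem hasOpenNullOrbit_of_eventually_mem_orbit {v : Tractor n} (hv0 : v ≠ 0)
    (hv : tractorMetric g x v v = 0) (h : ∀ᶠ u in 𝓝 v, tractorMetric g x u u = 0 →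
      ∃ A ∈ holonomy0 g x, A v = u) : HasOpenNullOrbit g x := by
  refine ⟨v, hv0, hv, fun A₀ hA₀ => ?_⟩
  have hinj : Function.Injective (A₀ : Tractor n →ₗ[ℝ] Tractor n) :=
    (isScalarProduct_metricAt g x).tractorBil.injective_of_isometry
      (h' := tractorBil (metricAt g x)) (isometry_of_mem_holonomy0 hA₀)
  let e := (LinearEquiv.ofInjectiveEndo _ hinj).toContinuousLinearEquiv
  have htendsto : Filter.Tendsto e.symm (𝓝 (A₀ v)) (𝓝 v) :=
    e.symm.continuous.tendsto' _ _ (e.symm_apply_apply v)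
  filter_upwards [htendsto.eventually h] with u hu hu0
  have heu : A₀ (e.symm u) = u := e.apply_symm_apply u
  obtain ⟨A, hA, hAu⟩ := hu (by rw [← isometry_of_mem_holonomy0 hA₀, heu, hu0])
  exact ⟨A₀ * A, (holonomySubmonoid g x).mul_mem hA₀ hA, by
    rw [mul_apply_eq_comp, hAu, heu]⟩

theorem hasOpenNullOrbit_of_mem_interior_closure (hn : 3 ≤ n)
    (hx : x ∈ interior (closure {y | rankE g y ≠ 0})) : HasOpenNullOrbit g x := by
  obtain ⟨z, hz⟩ := exists_mem_orbitTangent_of_dense_wedge hn (isScalarProduct_metricAt g x)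
    (holAlg g x) ⟨0, zero_mem_interior_closure_wedge_nullVec g hx⟩
  exact hasOpenNullOrbit_of_eventually_mem_orbit (nullVec_ne_zero _ _)
    (tractorBil_nullVec_self _ _) (eventually_mem_orbit hz)

theorem IsTransport.hasOpenNullOrbit {γ : Path x y} {P : Tractor n ≃L[ℝ] Tractor n}
    (h : IsTransport g γ P) (hy : HasOpenNullOrbit g y) : HasOpenNullOrbit g x := by
  obtain ⟨v, hv0, hv, hopen⟩ := hy
  have hiso : ∀ u w, tractorMetric g y (P u) (P w) = tractorMetric g x u w := h.isometry
  refine ⟨P.symm v, by simpa using hv0, by rw [← hiso, P.apply_symm_apply, hv], fun A₀ hA₀ => ?_⟩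
  have hPA₀ := hopen _ (h.symm.conj_mem_holonomy0 hA₀)
  have htendsto : Filter.Tendsto P (𝓝 (A₀ (P.symm v))) (𝓝 (P (A₀ (P.symm v)))) :=
    P.continuous.continuousAt
  filter_upwards [htendsto.eventually hPA₀] with u hu hu0
  obtain ⟨A, hA, hAu⟩ := hu (by rw [hiso, hu0])
  exact ⟨_, h.conj_mem_holonomy0 hA, by simp [hAu]⟩

theorem eventually_hasOpenNullOrbit_iff (g : Metric n p q M) (x₀ : M) :
    ∀ᶠ y in 𝓝 x₀, HasOpenNullOrbit g y ↔ HasOpenNullOrbit g x₀ := by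
  obtain ⟨P, hP, -⟩ := exists_local_transport g x₀
  rw [← chartParam_zero (n := n) x₀,
    ← (chartParam x₀).map_nhds_eq (zero_mem_chartParam_source x₀), chartParam_zero,
    Filter.eventually_map]
  filter_upwards [hP] with ξ ⟨γ, hγ⟩
  exact ⟨hγ.hasOpenNullOrbit, hγ.symm.hasOpenNullOrbit (P := (P ξ).symm)⟩

theorem HasOpenNullOrbit.of_preconnectedSpace [PreconnectedSpace M] (h : HasOpenNullOrbit g x)
    (y : M) : HasOpenNullOrbit g y := by
  have hconst : IsLocallyConstant (HasOpenNullOrbit g) :=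
    (IsLocallyConstant.iff_eventually_eq _).2 fun z =>
      (eventually_hasOpenNullOrbit_iff g z).mono fun _ => propext
  exact hconst.apply_eq_of_preconnectedSpace x y ▸ h

end OpenOrbit

section Frames

variable {n p q : ℕ}

theorem eq_zero_of_pseudoInner {v : PseudoSpace p q} (h : ∀ w, pseudoInner v w = 0) : v = 0 := by
  funext k
  have hk := h (Pi.single k 1)
  rcases k with i | j
  · simpa [pseudoInner, Pi.single_apply] using hk
  · simpa [pseudoInner, Pi.single_apply] using hk

theorem apply_equivFun_symm_of_pseudoOrthonormal {V : Type*} [NormedAddCommGroup V]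
    [NormedSpace ℝ V] {b : V →L[ℝ] V →L[ℝ] ℝ} {e : Module.Basis (Fin p ⊕ Fin q) ℝ V}
    (he : ∀ i j, b (e i) (e j) = if i = j then Sum.elim (fun _ => (-1 : ℝ)) (fun _ => 1) i else 0)
    (v w : Fin p ⊕ Fin q → ℝ) : b (e.equivFun.symm v) (e.equivFun.symm w) =
      -∑ i, v (Sum.inl i) * w (Sum.inl i) + ∑ j, v (Sum.inr j) * w (Sum.inr j) := by
  simp [Module.Basis.equivFun_symm_apply, he, sum_apply]

/-- The frame of the tractor bundle built from a basis of the tangent space: the first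
coordinates `a` and `a'` of the negative and the positive part give `(a' - a) s₋ + ½(a + a') s₊`,
the other ones are components with respect to the basis. -/
def tractorFrame (e : Module.Basis (Fin p ⊕ Fin q) ℝ (E n)) :
    PseudoSpace p q →ₗ[ℝ] Tractor n where
  toFun v := (v (Sum.inr 0) - v (Sum.inl 0),
    e.equivFun.symm (LinearMap.funLeft ℝ ℝ (Sum.map Fin.succ Fin.succ) v),
    1 / 2 * (v (Sum.inl 0) + v (Sum.inr 0)))
  map_add' v w := by
    simp only [map_add, Pi.add_apply, Prod.mk_add_mk, Prod.mk.injEq, true_and]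
    constructor <;> ring
  map_smul' c v := by
    simp only [map_smul, Pi.smul_apply, smul_eq_mul, Prod.smul_mk, RingHom.id_apply,
      Prod.mk.injEq, true_and]
    constructor <;> ring

theorem tractorFrame_apply (e : Module.Basis (Fin p ⊕ Fin q) ℝ (E n)) (v : PseudoSpace p q) :
    tractorFrame e v = (v (Sum.inr 0) - v (Sum.inl 0),
      e.equivFun.symm fun k => v (Sum.map Fin.succ Fin.succ k),
      1 / 2 * (v (Sum.inl 0) + v (Sum.inr 0))) := rfl

theorem tractorBil_tractorFrame {b : Bil n} {e : Module.Basis (Fin p ⊕ Fin q) ℝ (E n)}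
    (he : ∀ i j, b (e i) (e j) = if i = j then Sum.elim (fun _ => (-1 : ℝ)) (fun _ => 1) i else 0)
    (v w : PseudoSpace p q) :
    tractorBil b (tractorFrame e v) (tractorFrame e w) = pseudoInner v w := by
  rw [tractorBil_apply, tractorFrame_apply, tractorFrame_apply]
  dsimp only
  rw [apply_equivFun_symm_of_pseudoOrthonormal he, pseudoInner, Fin.sum_univ_succ,
    Fin.sum_univ_succ]
  simp only [Sum.map_inl, Sum.map_inr]
  ring

theorem finrank_pseudoSpace_eq_finrank_tractor (e : Module.Basis (Fin p ⊕ Fin q) ℝ (E n)) :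
    Module.finrank ℝ (PseudoSpace p q) = Module.finrank ℝ (Tractor n) := by
  have hn := Module.finrank_eq_card_basis e
  simp only [finrank_euclideanSpace_fin, Fintype.card_sum, Fintype.card_fin] at hn
  simp only [Module.finrank_fintype_fun_eq_card, Module.finrank_prod, finrank_euclideanSpace_fin,
    Module.finrank_self, Fintype.card_sum, Fintype.card_fin]
  omega

variable {M : Type*} [TopologicalSpace M] [ChartedSpace (E n) M] [IsManifold (𝓡 n) ∞ M]

theorem exists_isTractorFrame (g : Metric n p q M) (x : M) :
    ∃ ψ : PseudoSpace p q ≃ₗ[ℝ] Tractor n, IsTractorFrame g x ψ := by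
  obtain ⟨e : Module.Basis (Fin p ⊕ Fin q) ℝ (E n), he⟩ := g.signature x
  have hiso := tractorBil_tractorFrame (b := metricAt g x) he
  have hinj : Function.Injective (tractorFrame e) :=
    (injective_iff_map_eq_zero _).2 fun v hv => eq_zero_of_pseudoInner fun w => by
      rw [← hiso, hv, map_zero, zero_apply]
  exact ⟨(tractorFrame e).linearEquivOfInjective hinj (finrank_pseudoSpace_eq_finrank_tractor e),
    hiso⟩

theorem hasOpenOrbit_of_forall {g : Metric n p q M} (h : ∀ x, HasOpenNullOrbit g x) :
    HasOpenOrbit g := by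
  refine fun x => ⟨exists_isTractorFrame g x, fun ψ hψ => ?_⟩
  obtain ⟨v, hv0, hv, hopen⟩ := h x
  refine ⟨ψ.symm v, ⟨by simpa using hv0, by rw [← hψ, ψ.apply_symm_apply, hv]⟩,
    isOpen_iff_mem_nhds.2 ?_⟩
  rintro w ⟨A₀, hA₀, hw⟩
  rw [ψ.apply_symm_apply, ψ.symm_apply_eq] at hw
  have hψc : Continuous ψ := ψ.toLinearMap.continuous_of_finiteDimensional
  have htendsto : Filter.Tendsto (fun w' : nullCone p q => ψ w') (𝓝 w) (𝓝 (A₀ v)) :=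
    (hψc.comp continuous_subtype_val).tendsto' _ _ hw.symm
  filter_upwards [htendsto.eventually (hopen A₀ hA₀)] with w' hw'
  obtain ⟨A, hA, hAw⟩ := hw' (by rw [hψ, w'.2.2])
  exact ⟨A, hA, by rw [ψ.apply_symm_apply, hAw, ψ.symm_apply_apply]⟩

end Frames

end ConfHol

end

theorem mainTheorem8_general {n p q : ℕ} (hn : 3 ≤ n)
    {M : Type*} [TopologicalSpace M] [PreconnectedSpace M]
    [ChartedSpace (ConfHol.E n) M] [IsManifold (𝓡 n) ∞ M] (g : ConfHol.Metric n p q M) :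
    (∃ U : Set M, IsOpen U ∧ Dense U ∧ ∀ x ∈ U, ConfHol.rankE g x = 0) ∨
      ConfHol.HasOpenOrbit g := by
  rcases (interior (closure {y | ConfHol.rankE g y ≠ 0})).eq_empty_or_nonempty with
    hempty | ⟨x₀, hx₀⟩
  · refine .inl ⟨(closure {y | ConfHol.rankE g y ≠ 0})ᶜ, isClosed_closure.isOpen_compl,
      interior_eq_empty_iff_dense_compl.1 hempty, fun x hx => ?_⟩
    exact not_not.1 fun hrank => hx (subset_closure hrank)
  · have horbit := ConfHol.hasOpenNullOrbit_of_mem_interior_closure hn hx₀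
    exact .inr (ConfHol.hasOpenOrbit_of_forall horbit.of_preconnectedSpace)

theorem mainTheorem8 {n p q : ℕ} (hn : 3 ≤ n) (hn_even : Even n)
    {M : Type*} [TopologicalSpace M] [T2Space M] [SecondCountableTopology M] [ConnectedSpace M]
    [ChartedSpace (ConfHol.E n) M] [IsManifold (𝓡 n) ∞ M]
    (c : ConfHol.ConformalStructure n p q M) (g : ConfHol.Metric n p q M) (hg : g ∈ c) :
    (∃ U : Set M, IsOpen U ∧ Dense U ∧ ∀ x ∈ U, ConfHol.rankE g x ≤ 1) ∨
      ConfHol.HasOpenOrbit g :=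
  (mainTheorem8_general hn g).imp_left fun ⟨U, hU, hdense, hrank⟩ =>
    ⟨U, hU, hdense, fun x hx => (hrank x hx).le.trans zero_le_one⟩
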